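/- Let $B$ be a metric structure in a (many-sorted, bounded) metric language $\mathcal L$, let $K=\{0,1\}^{\mathbb N}$ be the Cantor space, and let $KB$ be the $\mathcal L$-structure whose sort $S$ is the space $C(K,S(B))$ of continuous functions with the uniform metric, with function symbols interpreted pointwise and relation symbols interpreted by $R^{KB}(\bar f)=\sup_{x\in K}R^B(\bar f(x))$. For a proper ideal $\mathcal J$ on $\mathbb N$, the reduced power $B^{\mathcal J}$ is the quotient of $B^{\mathbb N}$ (taken sort by sort) by the pseudometric $d(a,b)=\inf_{X\in\mathcal J}\sup_{j\notin X}d(a_j,b_j)$, with function symbols interpreted pointwise and $R(\bar a)=\inf_{X\in\mathcal J}\sup_{j\notin X}R^B(\bar a_j)$. Let $\iota_{B,K}\colon B\to KB$ and $\iota_{B,\mathcal J}\colon B\to B^{\mathcal J}$ be the diagonal embeddings (constant functions, constant sequences). For an ultrafilter $\mathcal U$ on $\mathbb N$, let $B^{\mathcal U}=B^{\mathcal J}$, where $\mathcal J=\mathcal P(\mathbb N)\setminus\mathcal U$, and write $\iota_{B,\mathcal U}$ for $\iota_{B,\mathcal J}$. Let $\mathcal I$ be a proper ideal on $\mathbb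 N$ such that the Boolean algebra $\mathcal P(\mathbb N)/\mathcal I$ is atomless. A dyadic tree of $\mathcal I$-positive sets is a family $(X_s)_{s\in\{0,1\}^{<\mathbb N}}$ of subsets of $\mathbb N$ not in $\mathcal I$ such that $X_{\langle\rangle}=\mathbb N$ and $X_s=X_{s^\frown 0}\sqcup X_{s^\frown 1}$ for all $s$. The map $\Psi\colon KB\to B^{\mathcal I}$ given by such a tree is the continuous map such that, whenever $f\in KB$ depends only on the first $n$ coordinates, $\Psi(f)$ is represented by the sequence that for every $s\in\{0,1\}^n$ is constant on $X_s$, with value $f(x)$ for any $x\in K$ extending $s$. Then the following hold. 1. Dyadic trees of $\mathcal I$-positive sets exist, and every such tree gives a unique map $\Psi$ as above. For every such tree, $\Psi\colon KB\to B^{\mathcal I}$ is an elementary embedding and $\iota_{B,\mathcal I}=\Psi\circ\iota_{B,K}$. 2. Let $\mathcal U$ be an ultrafilter on $\mathbb N$ disjoint from $\mathcal I$, let $\pi_{\mathcal U}\colon B^{\mathcal I}\to B^{\mathcal U}$ be the quotient map, let $p\in K$, and let $\pi_0\colon KB\to B$ be the evaluation at $p$. Then there is a dyadic tree of $\mathcal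 I$-positive sets such that for the map $\Psi$ given by it $$(\Psi,\iota_{B,\mathcal U})\colon (KB,B,\pi_0)\to(B^{\mathcal I},B^{\mathcal U},\pi_{\mathcal U})$$ is an elementary embedding, in the language consisting of two copies of $\mathcal L$ and a (1-Lipschitz) function symbol, for each sort, from the first copy to the second. -/

import Mathlib

universe u v w

noncomputable section

namespace ContLogic

/-! ### Languages, structures and formulas of (many-sorted, bounded) continuous logic -/

/-- A many-sorted metric language. Each sort carries a bound on its diameter, each function and
relation symbol a sorted arity and a modulus of uniform continuity, and each relation symbol a
compact interval of values. -/
structure MetricLanguage where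
  Sorts : Type u
  Func : Type u
  Rel : Type u
  diam : Sorts → ℝ
  funArity : Func → ℕ
  funDom : (f : Func) → Fin (funArity f) → Sorts
  funCod : Func → Sorts
  funMod : Func → ℝ → ℝ
  funMod_pos : ∀ f ε, 0 < ε → 0 < funMod f ε
  relArity : Rel → ℕ
  relDom : (R : Rel) → Fin (relArity R) → Sorts
  relLo : Rel → ℝ
  relHi : Rel → ℝ
  relMod : Rel → ℝ → ℝ
  relMod_pos : ∀ R ε, 0 < ε → 0 < relMod R ε

/-- A metric structure: every sort is a nonempty complete metric space whose diameter respects the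
bound of the language, and the symbols are interpreted by maps that respect the moduli of uniform
continuity and the bounds prescribed by the language. -/
structure MetricStructure (L : MetricLanguage.{u}) where
  carrier : L.Sorts → Type v
  [metric : ∀ S, MetricSpace (carrier S)]
  [complete : ∀ S, CompleteSpace (carrier S)]
  [nonempty : ∀ S, Nonempty (carrier S)]
  dist_le : ∀ S (x y : carrier S), dist x y ≤ L.diam S
  func : ∀ f : L.Func, (∀ i, carrier (L.funDom f i)) → carrier (L.funCod f)
  func_unif : ∀ (f : L.Func) (x y : ∀ i, carrier (L.funDom f i)) (ε : ℝ), 0 < ε →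
    (∀ i, dist (x i) (y i) < L.funMod f ε) → dist (func f x) (func f y) ≤ ε
  rel : ∀ R : L.Rel, (∀ i, carrier (L.relDom R i)) → ℝ
  rel_mem : ∀ (R : L.Rel) (x : ∀ i, carrier (L.relDom R i)),
    rel R x ∈ Set.Icc (L.relLo R) (L.relHi R)
  rel_unif : ∀ (R : L.Rel) (x y : ∀ i, carrier (L.relDom R i)) (ε : ℝ), 0 < ε →
    (∀ i, dist (x i) (y i) < L.relMod R ε) → |rel R x - rel R y| ≤ ε

attribute [instance] MetricStructure.metric MetricStructure.complete MetricStructure.nonempty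

/-- `SVar Γ S` is the type of variables of sort `S` in the finite sorted context `Γ`. -/
inductive SVar {A : Type u} : List A → A → Type u
  | zero {Γ : List A} {S : A} : SVar (S :: Γ) S
  | succ {Γ : List A} {S S' : A} : SVar Γ S → SVar (S' :: Γ) S

/-- Terms with free variables from `Γ`. -/
inductive STerm (L : MetricLanguage.{u}) (Γ : List L.Sorts) : L.Sorts → Type u
  | var {S : L.Sorts} : SVar Γ S → STerm L Γ S
  | app (f : L.Func) : (∀ i, STerm L Γ (L.funDom f i)) → STerm L Γ (L.funCod f)

/-- Formulas of continuous logic with free variables from `Γ`: atomic formulas, continuous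
real-valued connectives, and the quantifiers `sup` and `inf` over a sort. -/
inductive SFormula (L : MetricLanguage.{u}) : List L.Sorts → Type u
  | eqDist {Γ : List L.Sorts} {S : L.Sorts} : STerm L Γ S → STerm L Γ S → SFormula L Γ
  | rel {Γ : List L.Sorts} (R : L.Rel) : (∀ i, STerm L Γ (L.relDom R i)) → SFormula L Γ
  | conn {Γ : List L.Sorts} (n : ℕ) (c : C(Fin n → ℝ, ℝ)) : (Fin n → SFormula L Γ) → SFormula L Γ
  | sup {Γ : List L.Sorts} (S : L.Sorts) : SFormula L (S :: Γ) → SFormula L Γ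
  | inf {Γ : List L.Sorts} (S : L.Sorts) : SFormula L (S :: Γ) → SFormula L Γ

variable {L : MetricLanguage.{u}}

/-- A tuple of elements of `M` of the sorts listed in `Γ`. -/
abbrev Tuple (M : MetricStructure.{u, v} L) (Γ : List L.Sorts) : Type (max u v) :=
  ∀ S, SVar Γ S → M.carrier S

/-- Adding one element in front of a tuple. -/
def Tuple.cons {M : MetricStructure.{u, v} L} {Γ : List L.Sorts} {S : L.Sorts}
    (x : M.carrier S) (a : Tuple M Γ) : Tuple M (S :: Γ)
  | _, .zero => x
  | _, .succ y => a _ y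

/-- The value of a term. -/
def STerm.eval (M : MetricStructure.{u, v} L) {Γ : List L.Sorts} (a : Tuple M Γ) :
    {S : L.Sorts} → STerm L Γ S → M.carrier S
  | _, .var y => a _ y
  | _, .app f t => M.func f fun i => (t i).eval M a

/-- The value of a formula in `M` at the tuple `a`. -/
def SFormula.eval (M : MetricStructure.{u, v} L) :
    {Γ : List L.Sorts} → SFormula L Γ → Tuple M Γ → ℝ
  | _, .eqDist s t, a => dist (s.eval M a) (t.eval M a)
  | _, .rel R t, a => M.rel R fun i => (t i).eval M a
  | _, .conn _ c φ, a => c fun i => (φ i).eval M a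
  | _, .sup S φ, a => ⨆ x : M.carrier S, φ.eval M (Tuple.cons x a)
  | _, .inf S φ, a => ⨅ x : M.carrier S, φ.eval M (Tuple.cons x a)

/-- A sort-preserving map between the underlying sets of two structures. -/
abbrev SortedMap (M : MetricStructure.{u, v} L) (N : MetricStructure.{u, w} L) :
    Type (max u v w) :=
  ∀ S, M.carrier S → N.carrier S

/-- Embeddings: isometric maps that commute with the function symbols and preserve the values of
the relation symbols. -/
def IsEmbedding {M : MetricStructure.{u, v} L} {N : MetricStructure.{u, w} L}
    (F : SortedMap M N) : Prop :=
  (∀ S, Isometry (F S)) ∧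
  (∀ (f : L.Func) (x : ∀ i, M.carrier (L.funDom f i)),
    F _ (M.func f x) = N.func f fun i => F _ (x i)) ∧
  ∀ (R : L.Rel) (x : ∀ i, M.carrier (L.relDom R i)),
    N.rel R (fun i => F _ (x i)) = M.rel R x

/-- Elementary embeddings: embeddings that preserve the values of all formulas. -/
def IsElementaryEmbedding {M : MetricStructure.{u, v} L} {N : MetricStructure.{u, w} L}
    (F : SortedMap M N) : Prop :=
  IsEmbedding F ∧
  ∀ (Γ : List L.Sorts) (φ : SFormula L Γ) (a : Tuple M Γ),
    φ.eval N (fun S y => F S (a S y)) = φ.eval M a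

/-! ### Structures of the form `(M, N, π)` -/

/-- The language of triples `(M, N, π)`: two copies of `L` and, for every sort of `L`, a
1-Lipschitz function symbol from the first copy of the sort to the second one. -/
def MetricLanguage.pair (L : MetricLanguage.{u}) : MetricLanguage.{u} where
  Sorts := L.Sorts ⊕ L.Sorts
  Func := (L.Func ⊕ L.Func) ⊕ L.Sorts
  Rel := L.Rel ⊕ L.Rel
  diam
    | .inl S => L.diam S
    | .inr S => L.diam S
  funArity
    | .inl (.inl f) => L.funArity f
    | .inl (.inr f) => L.funArity f
    | .inr _ => 1
  funDom
    | .inl (.inl f) => fun i => .inl (L.funDom f i)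
    | .inl (.inr f) => fun i => .inr (L.funDom f i)
    | .inr S => fun _ => .inl S
  funCod
    | .inl (.inl f) => .inl (L.funCod f)
    | .inl (.inr f) => .inr (L.funCod f)
    | .inr S => .inr S
  funMod
    | .inl (.inl f) => L.funMod f
    | .inl (.inr f) => L.funMod f
    | .inr _ => fun ε => ε
  funMod_pos := by
    rintro ((f | f) | S) ε hε
    · exact L.funMod_pos f ε hε
    · exact L.funMod_pos f ε hε
    · exact hε
  relArity
    | .inl R => L.relArity R
    | .inr R => L.relArity R
  relDom
    | .inl R => fun i => .inl (L.relDom R i)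
    | .inr R => fun i => .inr (L.relDom R i)
  relLo
    | .inl R => L.relLo R
    | .inr R => L.relLo R
  relHi
    | .inl R => L.relHi R
    | .inr R => L.relHi R
  relMod
    | .inl R => L.relMod R
    | .inr R => L.relMod R
  relMod_pos := by
    rintro (R | R) ε hε <;> exact L.relMod_pos R ε hε

/-- The underlying sorts of `(M, N, π)`. -/
def PairCarrier (M N : MetricStructure.{u, v} L) : L.pair.Sorts → Type v
  | .inl S => M.carrier S
  | .inr S => N.carrier S

instance pairMetric (M N : MetricStructure.{u, v} L) : ∀ s, MetricSpace (PairCarrier M N s)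
  | .inl S => M.metric S
  | .inr S => N.metric S

instance pairComplete (M N : MetricStructure.{u, v} L) : ∀ s, CompleteSpace (PairCarrier M N s)
  | .inl S => M.complete S
  | .inr S => N.complete S

instance pairNonempty (M N : MetricStructure.{u, v} L) : ∀ s, Nonempty (PairCarrier M N s)
  | .inl S => M.nonempty S
  | .inr S => N.nonempty S

/-- The structure `(M, N, π)` for a 1-Lipschitz map `π` from `M` to `N`. -/
def pairStructure (M N : MetricStructure.{u, v} L) (π : SortedMap M N)
    (hπ : ∀ S x y, dist (π S x) (π S y) ≤ dist x y) : MetricStructure.{u, v} L.pair where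
  carrier := PairCarrier M N
  metric := pairMetric M N
  complete := pairComplete M N
  nonempty := pairNonempty M N
  dist_le
    | .inl S => M.dist_le S
    | .inr S => N.dist_le S
  func
    | .inl (.inl f) => M.func f
    | .inl (.inr f) => N.func f
    | .inr S => fun x => π S (x (0 : Fin 1))
  func_unif
    | .inl (.inl f) => M.func_unif f
    | .inl (.inr f) => N.func_unif f
    | .inr S => fun x y _ _ h => (hπ S (x (0 : Fin 1)) (y (0 : Fin 1))).trans (h (0 : Fin 1)).le
  rel
    | .inl R => M.rel R
    | .inr R => N.rel R
  rel_mem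
    | .inl R => M.rel_mem R
    | .inr R => N.rel_mem R
  rel_unif
    | .inl R => M.rel_unif R
    | .inr R => N.rel_unif R

/-- The map `(F, G)` from `(M, N, π)` to `(M', N', π')`. -/
def pairMap {M N : MetricStructure.{u, v} L} {M' N' : MetricStructure.{u, w} L}
    {π : SortedMap M N} {hπ : ∀ S x y, dist (π S x) (π S y) ≤ dist x y}
    {π' : SortedMap M' N'} {hπ' : ∀ S x y, dist (π' S x) (π' S y) ≤ dist x y}
    (F : SortedMap M M') (G : SortedMap N N') :
    SortedMap (pairStructure M N π hπ) (pairStructure M' N' π' hπ')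
  | .inl S => F S
  | .inr S => G S

/-! ### The structure of continuous functions on the Cantor space -/

/-- The Cantor space. -/
abbrev Cantor : Type := ℕ → Bool

lemma MetricStructure.continuous_func (B : MetricStructure.{u, v} L) (f : L.Func) :
    Continuous (B.func f) := by
  rw [Metric.continuous_iff]
  intro x ε hε
  refine ⟨L.funMod f (ε / 2), L.funMod_pos f _ (half_pos hε), fun y hy => ?_⟩
  have := B.func_unif f y x (ε / 2) (half_pos hε) fun i => (dist_le_pi_dist y x i).trans_lt hy
  linarith

lemma MetricStructure.bddAbove_rel (B : MetricStructure.{u, v} L) (R : L.Rel) {ι : Type*}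
    (x : ι → ∀ i, B.carrier (L.relDom R i)) : BddAbove (Set.range fun j => B.rel R (x j)) :=
  ⟨L.relHi R, by rintro _ ⟨j, rfl⟩; exact (B.rel_mem R _).2⟩

/-- `KB`: the continuous functions from the Cantor space to `B` with the uniform metric. Function
symbols are interpreted pointwise, and relation symbols by the supremum of the pointwise values. -/
def KStr (B : MetricStructure.{u, v} L) : MetricStructure.{u, v} L where
  carrier S := C(Cantor, B.carrier S)
  nonempty S := ⟨ContinuousMap.const Cantor (Classical.choice (B.nonempty S))⟩
  dist_le S f g := (ContinuousMap.dist_le_iff_of_nonempty).2 fun x => B.dist_le S _ _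
  func f a := ⟨fun x => B.func f fun i => a i x,
    (B.continuous_func f).comp (continuous_pi fun i => (a i).continuous)⟩
  func_unif f a b ε hε h := (ContinuousMap.dist_le_iff_of_nonempty).2 fun x =>
    B.func_unif f _ _ ε hε fun i => (ContinuousMap.dist_apply_le_dist x).trans_lt (h i)
  rel R a := ⨆ x : Cantor, B.rel R fun i => a i x
  rel_mem R a := ⟨(B.rel_mem R _).1.trans (le_ciSup (B.bddAbove_rel R _) (fun _ => false)),
    ciSup_le fun x => (B.rel_mem R _).2⟩
  rel_unif R a b ε hε h := by
    have key : ∀ a b : (∀ i, C(Cantor, B.carrier (L.relDom R i))),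
        (∀ i, dist (a i) (b i) < L.relMod R ε) →
        (⨆ x : Cantor, B.rel R fun i => a i x) ≤ (⨆ x : Cantor, B.rel R fun i => b i x) + ε := by
      intro a b h
      refine ciSup_le fun x => ?_
      have h1 := B.rel_unif R (fun i => a i x) (fun i => b i x) ε hε
        fun i => (ContinuousMap.dist_apply_le_dist x).trans_lt (h i)
      have h2 := le_ciSup (B.bddAbove_rel R fun (x : Cantor) i => b i x) x
      have h3 := (abs_le.1 h1).2
      linarith
    rw [abs_le]
    have h1 := key a b h
    have h2 := key b a fun i => by rw [dist_comm]; exact h i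
    constructor <;> linarith

/-- The diagonal embedding of `B` into `KB`. -/
def diagK (B : MetricStructure.{u, v} L) : SortedMap B (KStr B) :=
  fun _ b => ContinuousMap.const Cantor b

/-- The evaluation map from `KB` to `B` at the point `p` of the Cantor space. -/
def evalAt (B : MetricStructure.{u, v} L) (p : Cantor) : SortedMap (KStr B) B :=
  fun S f => (show C(Cantor, B.carrier S) from f) p

lemma dist_evalAt_le (B : MetricStructure.{u, v} L) (p : Cantor) (S : L.Sorts)
    (f g : (KStr B).carrier S) : dist (evalAt B p S f) (evalAt B p S g) ≤ dist f g :=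
  ContinuousMap.dist_apply_le_dist (f := (show C(Cantor, B.carrier S) from f))
    (g := (show C(Cantor, B.carrier S) from g)) p

/-! ### Ideals on `ℕ`, the quotient `𝒫(ℕ) / I` and reduced powers -/

/-- Equality modulo the ideal `I`. -/
def idealSetoid (I : Order.Ideal (Set ℕ)) : Setoid (Set ℕ) where
  r X Y := X \ Y ∈ I ∧ Y \ X ∈ I
  iseqv :=
    { refl := fun X => by simp [-Set.bot_eq_empty]
      symm := fun h => ⟨h.2, h.1⟩
      trans := by
        rintro X Y Z ⟨h1, h2⟩ ⟨h3, h4⟩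
        constructor
        · refine I.lower ?_ (I.sup_mem h1 h3)
          intro x; simp; tauto
        · refine I.lower ?_ (I.sup_mem h2 h4)
          intro x; simp; tauto }

/-- The quotient `𝒫(ℕ) / I`. -/
def QuotientAlgebra (I : Order.Ideal (Set ℕ)) : Type := Quotient (idealSetoid I)

/-- The class of a set modulo `I`. -/
def QuotientAlgebra.mk (I : Order.Ideal (Set ℕ)) (X : Set ℕ) : QuotientAlgebra I :=
  Quotient.mk (idealSetoid I) X

/-- The order of the Boolean algebra `𝒫(ℕ) / I`: inclusion modulo `I`. -/
instance (I : Order.Ideal (Set ℕ)) : PartialOrder (QuotientAlgebra I) where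
  le := Quotient.lift₂ (fun X Y => X \ Y ∈ I) (by
    rintro X Y X' Y' ⟨h1, h2⟩ ⟨h3, h4⟩
    refine propext ⟨fun h => ?_, fun h => ?_⟩
    · refine I.lower ?_ (I.sup_mem h2 (I.sup_mem h h3))
      intro x; simp; tauto
    · refine I.lower ?_ (I.sup_mem h1 (I.sup_mem h h4))
      intro x; simp; tauto)
  le_refl := by
    rintro ⟨X⟩
    change X \ X ∈ I
    simp [-Set.bot_eq_empty]
  le_trans := by
    rintro ⟨X⟩ ⟨Y⟩ ⟨Z⟩ h1 h2
    change X \ Z ∈ I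
    refine I.lower ?_ (I.sup_mem (show X \ Y ∈ I from h1) (show Y \ Z ∈ I from h2))
    intro x; simp; tauto
  le_antisymm := by
    rintro ⟨X⟩ ⟨Y⟩ h1 h2
    exact Quotient.sound ⟨h1, h2⟩

instance (I : Order.Ideal (Set ℕ)) : OrderBot (QuotientAlgebra I) where
  bot := QuotientAlgebra.mk I ∅
  bot_le := by
    rintro ⟨X⟩
    change ∅ \ X ∈ I
    exact I.lower Set.sdiff_subset I.bot_mem

/-- The (nontrivial, when `I` is proper) Boolean algebra `𝒫(ℕ) / I` has no atoms. -/
def IsAtomless (I : Order.Ideal (Set ℕ)) : Prop := ∀ a : QuotientAlgebra I, ¬ IsAtom a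

/-- The maximal ideal of all sets that do not belong to the ultrafilter `U`. -/
def dualIdeal (U : Ultrafilter ℕ) : Order.Ideal (Set ℕ) where
  carrier := {X | X ∉ U}
  lower' := fun _ _ h hX hY => hX (Filter.mem_of_superset hY h)
  nonempty' := ⟨∅, U.empty_notMem⟩
  directed' := fun X hX Y hY =>
    ⟨X ∪ Y, fun h => (Ultrafilter.union_mem_iff.1 h).elim hX hY,
      Set.subset_union_left, Set.subset_union_right⟩

instance (U : Ultrafilter ℕ) : (dualIdeal U).IsProper where
  ne_univ h := by
    have : (Set.univ : Set ℕ) ∈ (dualIdeal U : Set (Set ℕ)) := h ▸ Set.mem_univ _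
    exact this Filter.univ_mem

/-- `inf_{X ∈ I} sup_{j ∉ X} r j`. -/
def limsupMod (I : Order.Ideal (Set ℕ)) (r : ℕ → ℝ) : ℝ :=
  ⨅ X : {X : Set ℕ // X ∈ I}, ⨆ j : {j : ℕ // j ∉ X.1}, r j

lemma exists_of_limsupMod_lt {I : Order.Ideal (Set ℕ)} {r : ℕ → ℝ} {c : ℝ} (hbdd : BddAbove (Set.range r))
    (h : limsupMod I r < c) : ∃ X ∈ I, ∀ j, j ∉ X → r j < c := by
  have : Nonempty {X : Set ℕ // X ∈ I} := ⟨⟨_, I.nonempty.some_mem⟩⟩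
  obtain ⟨X, hX⟩ := exists_lt_of_ciInf_lt h
  refine ⟨X.1, X.2, fun j hj => lt_of_le_of_lt ?_ hX⟩
  obtain ⟨C, hC⟩ := hbdd
  refine le_ciSup (f := fun j : {j : ℕ // j ∉ X.1} => r j) ⟨C, ?_⟩ ⟨j, hj⟩
  rintro _ ⟨k, rfl⟩
  exact hC ⟨k.1, rfl⟩

section limsupMod

variable {I : Order.Ideal (Set ℕ)} [hI : I.IsProper]

lemma nonempty_compl (X : {X : Set ℕ // X ∈ I}) : Nonempty {j : ℕ // j ∉ X.1} := by
  by_contra h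
  rw [not_nonempty_iff] at h
  have : X.1 = Set.univ := Set.eq_univ_of_forall fun j => by
    by_contra hj
    exact h.false ⟨j, hj⟩
  exact hI.ne_univ (Set.eq_univ_of_forall fun Y =>
    I.lower (show Y ≤ X.1 from this ▸ Set.subset_univ Y) X.2)

lemma limsupMod_le {r : ℕ → ℝ} {lo c : ℝ} (hlo : ∀ j, lo ≤ r j) (hbdd : BddAbove (Set.range r))
    {X : Set ℕ} (hX : X ∈ I) (h : ∀ j, j ∉ X → r j ≤ c) : limsupMod I r ≤ c := by
  have hne := nonempty_compl (I := I)
  refine (ciInf_le ⟨lo, ?_⟩ (⟨X, hX⟩ : {X : Set ℕ // X ∈ I})).trans ?_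
  · rintro _ ⟨Y, rfl⟩
    obtain ⟨j⟩ := hne Y
    obtain ⟨C, hC⟩ := hbdd
    refine (hlo j.1).trans (le_ciSup (f := fun j : {j : ℕ // j ∉ Y.1} => r j) ⟨C, ?_⟩ j)
    rintro _ ⟨k, rfl⟩
    exact hC ⟨k.1, rfl⟩
  · have := hne ⟨X, hX⟩
    exact ciSup_le fun j => h j.1 j.2

lemma le_limsupMod {r : ℕ → ℝ} {lo : ℝ} (hlo : ∀ j, lo ≤ r j) (hbdd : BddAbove (Set.range r)) :
    lo ≤ limsupMod I r := by
  by_contra! h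
  obtain ⟨X, hX, hr⟩ := exists_of_limsupMod_lt hbdd h
  obtain ⟨j⟩ := nonempty_compl (I := I) ⟨X, hX⟩
  exact absurd (hr j.1 j.2) (not_lt.2 (hlo j.1))

end limsupMod

/-- Representing sequences for the sort `S` of the reduced power of `B` modulo `I`. -/
def RepSeq (_I : Order.Ideal (Set ℕ)) (B : MetricStructure.{u, v} L) (S : L.Sorts) : Type v :=
  ℕ → B.carrier S

lemma bddAbove_dist (B : MetricStructure.{u, v} L) {S : L.Sorts} (a b : ℕ → B.carrier S) :
    BddAbove (Set.range fun j => dist (a j) (b j)) :=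
  ⟨L.diam S, by rintro _ ⟨j, rfl⟩; exact B.dist_le S _ _⟩

/-- The pseudometric `d(a, b) = inf_{X ∈ I} sup_{j ∉ X} d(a j, b j)`. -/
instance (I : Order.Ideal (Set ℕ)) [I.IsProper] (B : MetricStructure.{u, v} L) (S : L.Sorts) :
    PseudoMetricSpace (RepSeq I B S) where
  dist a b := limsupMod I fun j => dist (a j) (b j)
  dist_self a := by
    refine le_antisymm ?_ (le_limsupMod (fun j => dist_nonneg) (bddAbove_dist B a a))
    exact limsupMod_le (fun j => dist_nonneg) (bddAbove_dist B a a) I.bot_mem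
      fun j _ => (dist_self _).le
  dist_comm a b := by
    simp_rw [dist_comm]
  dist_triangle a b c := by
    refine le_of_forall_pos_le_add fun ε hε => ?_
    obtain ⟨X, hX, h1⟩ := exists_of_limsupMod_lt (I := I) (bddAbove_dist B a b)
      (lt_add_of_pos_right _ (half_pos hε))
    obtain ⟨Y, hY, h2⟩ := exists_of_limsupMod_lt (I := I) (bddAbove_dist B b c)
      (lt_add_of_pos_right _ (half_pos hε))
    refine limsupMod_le (fun j => dist_nonneg) (bddAbove_dist B a c) (I.sup_mem hX hY)
      fun j hj => ?_
    have hj1 := h1 j fun h => hj (Or.inl h)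
    have hj2 := h2 j fun h => hj (Or.inr h)
    have := dist_triangle (a j) (b j) (c j)
    linarith

lemma RepSeq.dist_def {I : Order.Ideal (Set ℕ)} [I.IsProper] {B : MetricStructure.{u, v} L}
    {S : L.Sorts} (a b : RepSeq I B S) :
    dist a b = limsupMod I fun j => dist (a j) (b j) := rfl

lemma RepSeq.dist_le {I : Order.Ideal (Set ℕ)} [I.IsProper] {B : MetricStructure.{u, v} L}
    {S : L.Sorts} {a b : RepSeq I B S} {c : ℝ} {X : Set ℕ} (hX : X ∈ I)
    (h : ∀ j, j ∉ X → dist (a j) (b j) ≤ c) : dist a b ≤ c :=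
  limsupMod_le (fun _ => dist_nonneg) (bddAbove_dist B a b) hX h

lemma RepSeq.exists_of_dist_lt {I : Order.Ideal (Set ℕ)} [I.IsProper]
    {B : MetricStructure.{u, v} L} {S : L.Sorts} {a b : RepSeq I B S} {c : ℝ} (h : dist a b < c) :
    ∃ X ∈ I, ∀ j, j ∉ X → dist (a j) (b j) < c :=
  exists_of_limsupMod_lt (bddAbove_dist B a b) h

lemma exists_common {I : Order.Ideal (Set ℕ)} {n : ℕ} {P : Fin n → ℕ → Prop}
    (h : ∀ i, ∃ X ∈ I, ∀ j, j ∉ X → P i j) : ∃ X ∈ I, ∀ j, j ∉ X → ∀ i, P i j := by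
  choose X hX hP using h
  refine ⟨Finset.univ.sup X, (I.finsetSup_mem_iff).2 fun i _ => hX i, ?_⟩
  intro j hj i
  exact hP i j fun h => hj ((Finset.le_sup (f := X) (Finset.mem_univ i)) h)

instance (I : Order.Ideal (Set ℕ)) [I.IsProper] (B : MetricStructure.{u, v} L) (S : L.Sorts) :
    CompleteSpace (RepSeq I B S) := by
  refine Metric.complete_of_convergent_controlled_sequences (fun n => (1 / 2 : ℝ) ^ n)
    (fun n => by positivity) fun a ha => ?_
  have h1 : ∀ n, ∃ X ∈ I, ∀ j, j ∉ X → dist (a n j) (a (n + 1) j) < (1 / 2 : ℝ) ^ n :=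
    fun n => RepSeq.exists_of_dist_lt (ha n n (n + 1) le_rfl n.le_succ)
  choose X hX hd using h1
  classical
  -- modify the sequence so that consecutive terms are uniformly close everywhere
  let b : ℕ → ℕ → B.carrier S := fun n => Nat.rec (a 0)
    (fun n c j => if ∃ m ≤ n, j ∈ X m then c j else a (n + 1) j) n
  have hb0 : b 0 = a 0 := rfl
  have hbs : ∀ n j, b (n + 1) j = if ∃ m ≤ n, j ∈ X m then b n j else a (n + 1) j :=
    fun n j => rfl
  have hba : ∀ n j, (∀ m < n, j ∉ X m) → b n j = a n j := by
    intro n j h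
    cases n with
    | zero => rfl
    | succ n =>
      rw [hbs, if_neg]
      rintro ⟨m, hm, hj⟩
      exact h m (Nat.lt_succ_of_le hm) hj
  have hbd : ∀ j n, dist (b n j) (b (n + 1) j) ≤ 1 / 2 / 2 ^ n * 2 := by
    intro j n
    have e : (1 : ℝ) / 2 / 2 ^ n * 2 = (1 / 2) ^ n := by rw [one_div_pow]; ring
    rw [e, hbs]
    split_ifs with h
    · rw [dist_self]; positivity
    · push Not at h
      rw [hba n j fun m hm => h m hm.le]
      exact (hd n j (h n le_rfl)).le
  have hbd2 : ∀ j n, dist (b n j) (b (n + 1) j) ≤ 2 / 2 / 2 ^ n := fun j n => by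
    refine (hbd j n).trans (le_of_eq ?_); ring
  have hc : ∀ j, CauchySeq fun n => b n j := fun j => cauchySeq_of_le_geometric_two (hbd2 j)
  choose l hl using fun j => cauchySeq_tendsto_of_complete (hc j)
  refine ⟨l, ?_⟩
  refine Metric.tendsto_atTop.2 fun ε hε => ?_
  obtain ⟨N, hN⟩ := exists_pow_lt_of_lt_one (half_pos hε) (by norm_num : (1 / 2 : ℝ) < 1)
  refine ⟨N, fun n hn => ?_⟩
  have hXn : (Finset.range n).sup X ∈ I := (I.finsetSup_mem_iff).2 fun i _ => hX i
  have key : dist (a n) l ≤ 2 * (1 / 2 : ℝ) ^ n := by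
    refine RepSeq.dist_le hXn fun j hj => ?_
    rw [← hba n j fun m hm h => hj ((Finset.le_sup (f := X) (Finset.mem_range.2 hm)) h)]
    refine (dist_le_of_le_geometric_two_of_tendsto (hbd2 j) (hl j) n).trans (le_of_eq ?_)
    rw [one_div_pow]; ring
  have : (1 / 2 : ℝ) ^ n ≤ (1 / 2) ^ N := pow_le_pow_of_le_one (by norm_num) (by norm_num) hn
  linarith

/-- The element of the reduced power with a given representing sequence. -/
abbrev RepSeq.mk (I : Order.Ideal (Set ℕ)) [I.IsProper] (B : MetricStructure.{u, v} L)
    {S : L.Sorts} (a : ℕ → B.carrier S) : SeparationQuotient (RepSeq I B S) :=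
  SeparationQuotient.mk (show RepSeq I B S from a)

/-- A representing sequence of an element of the reduced power. -/
def RepSeq.rep {I : Order.Ideal (Set ℕ)} [I.IsProper] {B : MetricStructure.{u, v} L}
    {S : L.Sorts} (a : SeparationQuotient (RepSeq I B S)) : RepSeq I B S :=
  (SeparationQuotient.surjective_mk a).choose

lemma RepSeq.mk_rep {I : Order.Ideal (Set ℕ)} [I.IsProper] {B : MetricStructure.{u, v} L}
    {S : L.Sorts} (a : SeparationQuotient (RepSeq I B S)) :
    SeparationQuotient.mk (RepSeq.rep a) = a :=
  (SeparationQuotient.surjective_mk a).choose_spec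

lemma RepSeq.dist_rep {I : Order.Ideal (Set ℕ)} [I.IsProper] {B : MetricStructure.{u, v} L}
    {S : L.Sorts} (a b : SeparationQuotient (RepSeq I B S)) :
    dist (RepSeq.rep a) (RepSeq.rep b) = dist a b := by
  conv_rhs => rw [← RepSeq.mk_rep a, ← RepSeq.mk_rep b, SeparationQuotient.dist_mk]

/-- The reduced power of `B` modulo `I`. Function symbols are interpreted pointwise on representing
sequences, relation symbols by `inf_{X ∈ I} sup_{j ∉ X}` of the pointwise values; by uniform
continuity the choice of the representing sequences does not matter. -/
def RedPower (I : Order.Ideal (Set ℕ)) [I.IsProper] (B : MetricStructure.{u, v} L) :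
    MetricStructure.{u, v} L where
  carrier S := SeparationQuotient (RepSeq I B S)
  nonempty S := ⟨RepSeq.mk I B fun _ => Classical.choice (B.nonempty S)⟩
  dist_le S x y := by
    rw [← RepSeq.dist_rep]
    exact RepSeq.dist_le I.bot_mem fun j _ => B.dist_le S _ _
  func f a := RepSeq.mk I B fun j => B.func f fun i => RepSeq.rep (a i) j
  func_unif f a b ε hε h := by
    obtain ⟨X, hX, hd⟩ := exists_common fun i =>
      RepSeq.exists_of_dist_lt ((RepSeq.dist_rep (a i) (b i)).trans_lt (h i))
    rw [SeparationQuotient.dist_mk]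
    exact RepSeq.dist_le hX fun j hj => B.func_unif f _ _ ε hε (hd j hj)
  rel R a := limsupMod I fun j => B.rel R fun i => RepSeq.rep (a i) j
  rel_mem R a := ⟨le_limsupMod (fun j => (B.rel_mem R _).1) (B.bddAbove_rel R _),
    limsupMod_le (fun j => (B.rel_mem R _).1) (B.bddAbove_rel R _) I.bot_mem
      fun j _ => (B.rel_mem R _).2⟩
  rel_unif R a b ε hε h := by
    have key : ∀ a b : (∀ i, SeparationQuotient (RepSeq I B (L.relDom R i))),
        (∀ i, dist (a i) (b i) < L.relMod R ε) →
        limsupMod I (fun j => B.rel R fun i => RepSeq.rep (a i) j) ≤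
          limsupMod I (fun j => B.rel R fun i => RepSeq.rep (b i) j) + ε := by
      intro a b h
      obtain ⟨X, hX, hd⟩ := exists_common fun i =>
        RepSeq.exists_of_dist_lt ((RepSeq.dist_rep (a i) (b i)).trans_lt (h i))
      refine le_of_forall_pos_le_add fun η hη => ?_
      obtain ⟨Y, hY, hr⟩ := exists_of_limsupMod_lt (I := I)
        (B.bddAbove_rel R fun j i => RepSeq.rep (b i) j) (lt_add_of_pos_right _ hη)
      refine limsupMod_le (fun j => (B.rel_mem R _).1) (B.bddAbove_rel R _) (I.sup_mem hX hY)
        fun j hj => ?_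
      have h1 := (abs_le.1 (B.rel_unif R _ _ ε hε (hd j fun h => hj (Or.inl h)))).2
      have h2 := hr j fun h => hj (Or.inr h)
      linarith
    rw [abs_le]
    have h1 := key a b h
    have h2 := key b a fun i => by rw [dist_comm]; exact h i
    constructor <;> linarith

/-- The diagonal embedding of `B` into its reduced power modulo `I`. -/
def diag (I : Order.Ideal (Set ℕ)) [I.IsProper] (B : MetricStructure.{u, v} L) :
    SortedMap B (RedPower I B) :=
  fun _ b => RepSeq.mk I B fun _ => b

lemma RepSeq.dist_mono {I J : Order.Ideal (Set ℕ)} [I.IsProper] [J.IsProper] (hIJ : I ≤ J)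
    {B : MetricStructure.{u, v} L} {S : L.Sorts} (a b : ℕ → B.carrier S) :
    dist (show RepSeq J B S from a) (show RepSeq J B S from b) ≤
      dist (show RepSeq I B S from a) (show RepSeq I B S from b) := by
  refine le_of_forall_pos_le_add fun ε hε => ?_
  obtain ⟨X, hX, h⟩ := RepSeq.exists_of_dist_lt (lt_add_of_pos_right
    (dist (show RepSeq I B S from a) (show RepSeq I B S from b)) hε)
  exact RepSeq.dist_le (hIJ hX) fun j hj => (h j hj).le

/-- The quotient map between reduced powers modulo ideals `I ≤ J`. -/
def quotMap {I J : Order.Ideal (Set ℕ)} [I.IsProper] [J.IsProper] (hIJ : I ≤ J)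
    (B : MetricStructure.{u, v} L) : SortedMap (RedPower I B) (RedPower J B) :=
  fun _ => SeparationQuotient.lift (fun a => RepSeq.mk J B a) fun a b h =>
    SeparationQuotient.mk_eq_mk.2 (Metric.inseparable_iff.2 (le_antisymm
      ((RepSeq.dist_mono hIJ a b).trans (Metric.inseparable_iff.1 h).le) dist_nonneg))

lemma dist_quotMap_le {I J : Order.Ideal (Set ℕ)} [I.IsProper] [J.IsProper] (hIJ : I ≤ J)
    (B : MetricStructure.{u, v} L) (S : L.Sorts) (x y : (RedPower I B).carrier S) :
    dist (quotMap hIJ B S x) (quotMap hIJ B S y) ≤ dist x y := by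
  obtain ⟨a, rfl⟩ := SeparationQuotient.surjective_mk x
  obtain ⟨b, rfl⟩ := SeparationQuotient.surjective_mk y
  exact RepSeq.dist_mono hIJ a b

lemma le_dualIdeal {I : Order.Ideal (Set ℕ)} {U : Ultrafilter ℕ} (hU : ∀ X ∈ U, X ∉ I) :
    I ≤ dualIdeal U :=
  fun X hX h => hU X h hX

/-! ### The embeddings given by dyadic trees of positive sets -/

/-- A dyadic tree of `I`-positive sets, indexed by the finite sequences of zeros and ones. -/
structure DyadicTree (I : Order.Ideal (Set ℕ)) where
  X : List Bool → Set ℕ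
  root : X [] = Set.univ
  union : ∀ s, X (s ++ [false]) ∪ X (s ++ [true]) = X s
  disjoint : ∀ s, Disjoint (X (s ++ [false])) (X (s ++ [true]))
  pos : ∀ s, X s ∉ I

/-- The initial segment of length `n` of a point of the Cantor space. -/
def initSeg (x : Cantor) (n : ℕ) : List Bool := List.ofFn fun i : Fin n => x i

/-- `Ψ` is the map from `KB` to the reduced power given by the tree `T`: it is continuous, and if
`f` depends only on the first `n` coordinates then `Ψ f` is represented by the sequence that on
each set `T.X s` with `s` of length `n` is constantly equal to the value of `f` on the basic clopen
set of all points extending `s`. -/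
def DyadicTree.Induces {I : Order.Ideal (Set ℕ)} [I.IsProper] (T : DyadicTree I)
    (B : MetricStructure.{u, v} L) (Ψ : SortedMap (KStr B) (RedPower I B)) : Prop :=
  (∀ S, Continuous (Ψ S)) ∧
  ∀ (S : L.Sorts) (n : ℕ) (f : C(Cantor, B.carrier S)),
    (∀ x y, initSeg x n = initSeg y n → f x = f y) →
    ∀ a : ℕ → B.carrier S, (∀ x, ∀ j ∈ T.X (initSeg x n), a j = f x) →
      Ψ S f = RepSeq.mk I B a

end ContLogic

end

open Filter Topology

namespace ContLogic

/-! ### Frames -/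

/-! Let `β : ℕ → K` send `j` to the branch of the tree formed by the sets containing `j`. Then
`Ψ(f)` is the class of the sequence `f ∘ β`: this is the prescribed value when `f` depends on
finitely many coordinates, and such `f` are dense. Positivity of the sets in the tree says that
every point of `K` is a cluster point of `β` along the dual filter of the ideal, so a continuous
function on `K` and its pullback along `β` have the same essential range.

Essential ranges determine the values of formulas. Both `KB` and the reduced power are powers of `B`
over a `Frame`: elements are represented by continuous functions into `B`, and distances and
relations are essential suprema along a filter `F`, which is `⊤` on `K` and the dual filter of the
ideal on `ℕ`. Every `F`-positive clopen set splits into two positive ones, so a function on one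
frame can be imitated on the other. This is the back-and-forth step `Close.exists_extension`. It is
carried out for observables, uniformly continuous maps `ψ` with relatively compact range: a
quantifier over `x` replaces `ψ(x, a)` by the finitely many infima over `x` of `dist (ψ(x, a)) c`,
with `c` in a finite net. Induction on formulas gives `SFormula.isControlled`, and
`isElementaryEmbedding_of_comp` follows.

For the triples, a frame also carries an ultrafilter `G` extending `F`, and `Close` compares limits
along `G` as well. Both triples are powers of `(B, B, id)`, the first copy being measured along `F`
and the second along `G`. On `K` the ultrafilter is principal at `p`, on `ℕ` it is `U`. The tree is
chosen with its branch `p` inside `U`, so that `β` tends to `p` along `U`. -/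

/-- A frame: a topological space whose open covers have clopen disjoint refinements, with a filter
`F` for which no clopen set is an atom and an ultrafilter `G` that extends `F`. -/
structure Frame (J : Type) [TopologicalSpace J] where
  F : Filter J
  G : Ultrafilter J
  le : (G : Filter J) ≤ F
  exists_refinement : ∀ 𝒰 : Set (Set J), (∀ U ∈ 𝒰, IsOpen U) → (∀ j, ∃ U ∈ 𝒰, j ∈ U) →
    ∃ k : J → Set J, IsLocallyConstant k ∧ ∀ j, k j ∈ 𝒰 ∧ j ∈ k j
  split : ∀ Z, IsClopen Z → (∃ᶠ j in F, j ∈ Z) →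
    ∃ W, IsClopen W ∧ (∃ᶠ j in F, j ∈ Z ∧ j ∈ W) ∧ ∃ᶠ j in F, j ∈ Z ∧ j ∉ W

namespace Frame

variable {J : Type} [TopologicalSpace J] (A : Frame J)

lemma frequently_of_eventually {P : J → Prop} (h : ∀ᶠ j in (A.G : Filter J), P j) :
    ∃ᶠ j in A.F, P j :=
  h.frequently.filter_mono A.le

/-- The refinement axiom speaks of sets of open sets, which keeps index universes out of the
structure; this is the indexed form. It replaces continuous selection: witnesses to open conditions
can be chosen locally constantly. -/
lemma exists_locallyConstant (A : Frame J) {ι : Type*} (U : ι → Set J) (hU : ∀ i, IsOpen (U i))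
    (hc : ∀ j, ∃ i, j ∈ U i) : ∃ k : J → ι, IsLocallyConstant k ∧ ∀ j, j ∈ U (k j) := by
  classical
  obtain ⟨k, hk, hk'⟩ := A.exists_refinement (Set.range U) (by rintro _ ⟨i, rfl⟩; exact hU i) fun j => by
    obtain ⟨i, hi⟩ := hc j
    exact ⟨_, ⟨i, rfl⟩, hi⟩
  -- Over an empty space `ι` may be empty too, and `Function.invFun` would have no default value.
  by_cases hJ : IsEmpty J
  · exact ⟨fun j => hJ.elim j, fun s => by
      convert isOpen_empty using 1; exact Set.eq_empty_of_isEmpty _, fun j => hJ.elim j⟩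
  rw [not_isEmpty_iff] at hJ
  have : Nonempty ι := (hc hJ.some).nonempty
  refine ⟨fun j => Function.invFun U (k j), hk.comp (Function.invFun U), fun j => ?_⟩
  rw [Function.invFun_eq (hk' j).1]
  exact (hk' j).2

/-- Induction on `T`: split off a positive piece for the new value and use the positive remainder
for the others. -/
lemma exists_splitting {X : Type*} (T : Finset X) (hT : T.Nonempty) :
    ∀ Z, IsClopen Z → (∃ᶠ j in A.F, j ∈ Z) → ∃ k : J → X, IsLocallyConstant k ∧
      (∀ j, k j ∈ T) ∧ ∀ c ∈ T, ∃ᶠ j in A.F, j ∈ Z ∧ k j = c := by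
  classical
  induction hT using Finset.Nonempty.cons_induction with
  | singleton a =>
    intro Z _ hZ
    refine ⟨fun _ => a, IsLocallyConstant.const a, by simp, ?_⟩
    simpa using hZ
  | cons a s ha hs ih =>
    intro Z hZ hZ'
    obtain ⟨W, hW, h1, h2⟩ := A.split Z hZ hZ'
    obtain ⟨k, hk, hks, hkc⟩ := ih (Z ∩ Wᶜ) (hZ.inter hW.compl) h2
    refine ⟨fun j => if j ∈ W then a else k j, ?_, ?_, ?_⟩
    · rw [IsLocallyConstant.iff_eventually_eq] at hk ⊢
      intro j
      by_cases hj : j ∈ W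
      · filter_upwards [hW.isOpen.mem_nhds hj] with i hi
        rw [if_pos hj, if_pos hi]
      · filter_upwards [hW.compl.isOpen.mem_nhds hj, hk j] with i hi hi'
        rw [if_neg hj, if_neg hi, hi']
    · intro j
      dsimp only
      split_ifs
      · simp
      · simp [hks j]
    · intro c hc
      rcases Finset.mem_cons.1 hc with rfl | hc
      · refine h1.mono fun j hj => ⟨hj.1, if_pos hj.2⟩
      · refine (hkc c hc).mono fun j hj => ⟨hj.1.1, ?_⟩
        exact (if_neg hj.1.2).trans hj.2

/-- Every large clopen set can be shrunk so that its complement meets all positive pieces of a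
finite clopen partition in positive sets. -/
lemma exists_shrink {E : Type*} {g : J → E} (hg : IsLocallyConstant g) (hfin : (Set.range g).Finite)
    {V : Set J} (hV : IsClopen V) (hVG : V ∈ A.G) : ∃ V' ⊆ V, IsClopen V' ∧ V' ∈ A.G ∧
      ∀ e, (∃ᶠ j in A.F, g j = e) → ∃ᶠ j in A.F, g j = e ∧ j ∉ V' := by
  -- Since `g` has finitely many values, one of its fibres belongs to `G`. Only that fibre has to be
  -- split.
  obtain ⟨e₀, -, he₀⟩ := (Ultrafilter.eventually_exists_mem_iff (f := A.G) hfin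
    (P := fun e j => g j = e)).1 (Eventually.of_forall fun j => ⟨g j, ⟨j, rfl⟩, rfl⟩)
  obtain ⟨W, hW, h1, h2⟩ := A.split _ (hg.isClopen_fiber e₀) (A.frequently_of_eventually he₀)
  have key : ∀ W, IsClopen W → W ∈ A.G → (∃ᶠ j in A.F, g j = e₀ ∧ j ∉ W) →
      ∃ V' ⊆ V, IsClopen V' ∧ V' ∈ A.G ∧
        ∀ e, (∃ᶠ j in A.F, g j = e) → ∃ᶠ j in A.F, g j = e ∧ j ∉ V' := by
    intro W hW hWG h
    -- The fibre of `e₀` keeps its positive part outside `W`; the other fibres do not meet the new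
    -- set.
    refine ⟨V ∩ (W ∩ {j | g j = e₀}), Set.inter_subset_left,
      hV.inter (hW.inter (hg.isClopen_fiber e₀)), inter_mem hVG (inter_mem hWG he₀), ?_⟩
    intro e he
    by_cases hee : e = e₀
    · subst hee
      exact h.mono fun j hj => ⟨hj.1, fun hj' => hj.2 hj'.2.1⟩
    · exact he.mono fun j hj => ⟨hj, fun hj' => hee (hj.symm.trans hj'.2.2)⟩
  rcases A.G.mem_or_compl_mem W with h | h
  · exact key W hW h h2
  · exact key Wᶜ hW.compl h (h1.mono fun j hj => ⟨hj.1, fun hj' => hj' hj.2⟩)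

end Frame

/-- The functions `r` and `r'` on two frames have the same essential range and the same limit along
the ultrafilters, up to an error of `δ`. -/
def Close {J J' : Type} [TopologicalSpace J] [TopologicalSpace J'] (A : Frame J) (A' : Frame J')
    {X : Type} [PseudoMetricSpace X] (r : J → X) (r' : J' → X) (δ : ℝ) : Prop :=
  (∀ᶠ j in A.F, ∃ᶠ j' in A'.F, dist (r j) (r' j') < δ) ∧
  (∀ᶠ j' in A'.F, ∃ᶠ j in A.F, dist (r j) (r' j') < δ) ∧
  ∃ c, (∀ᶠ j in (A.G : Filter J), dist (r j) c < δ) ∧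
    ∀ᶠ j' in (A'.G : Filter J'), dist (r' j') c < δ

/-! ### Back and forth between two frames -/

section Close

variable {J J' : Type} [TopologicalSpace J] [TopologicalSpace J'] {A : Frame J} {A' : Frame J'}
  {X : Type} [PseudoMetricSpace X] {r : J → X} {r' : J' → X} {δ : ℝ}

lemma Close.symm (h : Close A A' r r' δ) : Close A' A r' r δ := by
  obtain ⟨h1, h2, c, h3, h4⟩ := h
  refine ⟨?_, ?_, c, h4, h3⟩
  · simpa only [dist_comm] using h2
  · simpa only [dist_comm] using h1

lemma Close.map {Y : Type} [PseudoMetricSpace Y] (h : Close A A' r r' δ) (π : X → Y)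
    (hπ : ∀ x y, dist (π x) (π y) ≤ dist x y) {ε : ℝ} (hε : δ ≤ ε) :
    Close A A' (fun j => π (r j)) (fun j => π (r' j)) ε := by
  obtain ⟨h1, h2, c, h3, h4⟩ := h
  have key : ∀ x y, dist x y < δ → dist (π x) (π y) < ε := fun x y hxy =>
    ((hπ x y).trans_lt hxy).trans_le hε
  exact ⟨h1.mono fun j hj => hj.mono fun _ => key _ _, h2.mono fun j hj => hj.mono fun _ => key _ _,
    π c, h3.mono fun _ => key _ _, h4.mono fun _ => key _ _⟩

/-- The extension property: a function into `Y` on the first frame is matched by one on the second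
frame, provided that the infima `inf_y dist (ψ y t) c`, for `c` in a finite net, are close. -/
theorem Close.exists_extension {T Y : Type*} [Nonempty Y] {ψ : Y → T → X} {D : Finset X} {η : ℝ}
    (hη : 0 < η) (hD : ∀ y t, ∃ c ∈ D, dist (ψ y t) c < η)
    (hE : ∃ E : Finset (D → ℝ), ∀ t, ∃ e ∈ E, dist (fun c : D => ⨅ y, dist (ψ y t) c) e < η)
    {a : J → T} {a' : J' → T}
    (hc : ∀ y, Continuous fun j => ψ y (a' j))
    (hcθ : Continuous fun j => (fun c : D => ⨅ y, dist (ψ y (a' j)) c))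
    (h : Close A A' (fun j => (fun c : D => ⨅ y, dist (ψ y (a j)) c))
      (fun j => (fun c : D => ⨅ y, dist (ψ y (a' j)) c)) η) (x : J → Y) :
    ∃ x' : J' → Y, IsLocallyConstant x' ∧
      Close A A' (fun j => ψ (x j) (a j)) (fun j => ψ (x' j) (a' j)) (5 * η) := by
  classical
  set θ : T → D → ℝ := fun t c => ⨅ y, dist (ψ y t) c with hθ
  have bdd : ∀ t (c : D), BddBelow (Set.range fun y => dist (ψ y t) c) := fun t c =>
    ⟨0, by rintro _ ⟨y, rfl⟩; exact dist_nonneg⟩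
  have θ_lt : ∀ y t (c : D), dist (ψ y t) c < η → θ t c < η := fun y t c hy =>
    (ciInf_le (bdd t c) y).trans_lt hy
  have lt_θ : ∀ t (c : D) C, θ t c < C → ∃ y, dist (ψ y t) c < C := fun t c C hC =>
    exists_lt_of_ciInf_lt hC
  have θ_dist : ∀ {f g : D → ℝ} {C : ℝ} (c : D), dist f g < C → f c < g c + C := by
    intro f g C c hfg
    have := (le_abs_self _).trans_lt ((dist_le_pi_dist f g c).trans_lt hfg)
    linarith
  obtain ⟨h1, h2, q, hq1, hq2⟩ := h
  obtain ⟨E, hE⟩ := hE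
  -- Discretisation: `h` is a point of the net `D` near the given values, and `g` is a locally
  -- constant approximation of `θ ∘ a'` by points of `E`.
  choose h hh using fun j => hD (x j) (a j)
  obtain ⟨g, hg, hgE⟩ := A'.exists_locallyConstant
    (fun e : E => {j | dist (θ (a' j)) e < η})
    (fun e => isOpen_lt (hcθ.dist continuous_const) continuous_const)
    fun j => by
      obtain ⟨e, he, hd⟩ := hE (a' j)
      exact ⟨⟨e, he⟩, hd⟩
  -- the limit along the ultrafilter
  obtain ⟨c₀, hc₀D, hc₀⟩ := (Ultrafilter.eventually_exists_mem_iff (f := A.G)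
    (is := (D : Set X)) D.finite_toSet
    (P := fun c j => dist (ψ (x j) (a j)) c < η)).1 (Eventually.of_forall fun j => ⟨h j, hh j⟩)
  -- One `η` for each of the two distances to the common limit `q`, and one for the distance from
  -- `c₀` to a value on the first frame.
  have hc₀' : ∀ᶠ j in (A'.G : Filter J'), θ (a' j) ⟨c₀, hc₀D⟩ < 3 * η := by
    obtain ⟨j, hj1, hj2⟩ := (hc₀.and hq1).exists
    filter_upwards [hq2] with j' hj'
    have e1 := θ_dist ⟨c₀, hc₀D⟩ hj'
    have e2 := θ_dist ⟨c₀, hc₀D⟩ (dist_comm q _ ▸ hj2)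
    have e3 := θ_lt (x j) (a j) ⟨c₀, hc₀D⟩ hj1
    linarith
  have hcont₀ : Continuous fun j => θ (a' j) ⟨c₀, hc₀D⟩ := (continuous_apply _).comp hcθ
  -- The open conditions `< 4 * η` and `> 3 * η` overlap and cover, so `b` cuts out a clopen set of
  -- the ultrafilter on which `c₀` is approximable.
  obtain ⟨b, hb, hb'⟩ := A'.exists_locallyConstant
    (fun b : Bool => if b then {j | θ (a' j) ⟨c₀, hc₀D⟩ < 4 * η}
      else {j | 3 * η < θ (a' j) ⟨c₀, hc₀D⟩})
    (by
      rintro (_ | _)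
      · simpa using isOpen_lt continuous_const hcont₀
      · simpa using isOpen_lt hcont₀ continuous_const)
    (fun j => by
      by_cases hj : θ (a' j) ⟨c₀, hc₀D⟩ < 4 * η
      · exact ⟨true, by simpa using hj⟩
      · exact ⟨false, by simp; linarith⟩)
  have hbG : {j | b j = true} ∈ A'.G := by
    filter_upwards [hc₀'] with j hj
    by_contra hbj
    have := hb' j
    simp only [Bool.not_eq_true] at hbj
    simp [hbj] at this
    linarith
  -- `V` is reserved for the limit along the ultrafilter. Its complement still has room to realise
  -- the essential range on every positive piece.
  obtain ⟨V, hVb, hV, hVG, hVpos⟩ := A'.exists_shrink hg (Set.toFinite _)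
    (hb.isClopen_fiber true) hbG
  have hVθ : ∀ j ∈ V, θ (a' j) ⟨c₀, hc₀D⟩ < 4 * η := fun j hj => by
    have := hb' j
    have hbj : b j = true := hVb hj
    simpa [hbj] using this
  -- the values that have to be taken on each piece
  let Tv : E → Finset D := fun e => Finset.univ.filter fun c =>
    ∃ᶠ j in A.F, h j = c ∧ dist (θ (a j)) e < 2 * η
  have hTv : ∀ e c, c ∈ Tv e ↔ ∃ᶠ j in A.F, h j = c ∧ dist (θ (a j)) e < 2 * η := by
    simp [Tv]
  have hTne : ∀ e, (∃ᶠ j in A'.F, g j = e) → (Tv e).Nonempty := by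
    intro e he
    obtain ⟨j', hj', hfr⟩ := (he.and_eventually h2).exists
    have h3 : ∃ᶠ j in A.F, ∃ c ∈ D, h j = c ∧ dist (θ (a j)) e < 2 * η := by
      -- The radius `2 * η` is one `η` from `θ (a j)` to `θ (a' j')` and one from there to `e`.
      refine hfr.mono fun j hj => ⟨h j, (hh j).1, rfl, ?_⟩
      have e1 := hgE j'
      rw [hj'] at e1
      have e2 : dist (θ (a j)) e ≤ _ := dist_triangle _ (θ (a' j')) _
      have e3 : dist (θ (a' j')) e < η := e1
      linarith
    by_contra hemp
    rw [Finset.not_nonempty_iff_eq_empty] at hemp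
    have h4 : ∀ c ∈ D, ∀ᶠ j in A.F, ¬ (h j = c ∧ dist (θ (a j)) e < 2 * η) := by
      intro c hc
      have : (⟨c, hc⟩ : D) ∉ Tv e := by simp [hemp]
      rw [hTv] at this
      exact not_frequently.1 this
    have h5 := (eventually_all_finset D).2 h4
    obtain ⟨j, ⟨c, hc, hj⟩, hj'⟩ := (h3.and_eventually h5).exists
    exact hj' c hc hj
  -- On each positive piece all required values are taken positively often outside `V`; a null piece
  -- gets a dummy constant.
  have hpos : ∀ e : E, ∃ k : J' → X, IsLocallyConstant k ∧ ((∃ᶠ j in A'.F, g j = e) →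
      (∀ j, ∃ c ∈ Tv e, k j = c) ∧
        ∀ c ∈ Tv e, ∃ᶠ j in A'.F, (g j = e ∧ j ∉ V) ∧ k j = c) := by
    intro e
    by_cases he : ∃ᶠ j in A'.F, g j = e
    · obtain ⟨k, hk, hk1, hk2⟩ := A'.exists_splitting (Tv e) (hTne e he)
        ({j | g j = e} ∩ Vᶜ) ((hg.isClopen_fiber e).inter hV.compl) (hVpos e he)
      refine ⟨fun j => k j, hk.comp _, fun _ => ⟨fun j => ⟨k j, hk1 j, rfl⟩, fun c hc => ?_⟩⟩
      exact (hk2 c hc).mono fun j hj => ⟨hj.1, congrArg Subtype.val hj.2⟩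
    · exact ⟨fun _ => c₀, IsLocallyConstant.const _, fun h => absurd h he⟩
  choose k₀ hk₀ hk using hpos
  set k : J' → X := fun j => k₀ (g j) j with hkdef
  have hkl : IsLocallyConstant k := by
    rw [IsLocallyConstant.iff_eventually_eq]
    intro j
    filter_upwards [hg.eventually_eq j, (hk₀ (g j)).eventually_eq j] with i hi hi'
    simp only [hkdef, hi, hi']
  -- the new function
  set good : J' → Prop := fun j => ∃ᶠ i in A'.F, g i = g j with hgood
  -- The new function aims at `c₀` on `V` and at `k` on the positive pieces outside `V`, with no
  -- demand on null pieces. For fixed `y` these conditions are open in `j`, so `y` can be chosen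
  -- locally constantly.
  obtain ⟨x', hx', hx'U⟩ := A'.exists_locallyConstant
    (fun y : Y => {j | j ∈ V ∧ dist (ψ y (a' j)) c₀ < 4 * η} ∪
      {j | j ∉ V ∧ (¬ good j ∨ dist (ψ y (a' j)) (k j) < 4 * η)})
    (fun y => by
      refine (hV.isOpen.inter
        (isOpen_lt ((hc y).dist continuous_const) continuous_const)).union
        (hV.compl.isOpen.inter (IsOpen.union ?_
          (isOpen_lt ((hc y).dist hkl.continuous) continuous_const)))
      exact (hg.comp fun e => ¬ ∃ᶠ i in A'.F, g i = e) {p | p})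
    (fun j => by
      by_cases hjV : j ∈ V
      · obtain ⟨y, hy⟩ := lt_θ _ _ _ (hVθ j hjV)
        exact ⟨y, Or.inl ⟨hjV, hy⟩⟩
      · by_cases hj : good j
        · obtain ⟨c, hcT, hkc⟩ := (hk (g j) hj).1 j
          obtain ⟨i, hi1, hi2⟩ := ((hTv _ _).1 hcT).exists
          have e1 : θ (a i) c < η := θ_lt (x i) (a i) c (hi1 ▸ (hh i).2)
          have e2 := θ_dist c (dist_comm _ (g j : D → ℝ) ▸ hi2)
          have e3 := θ_dist c (show dist (θ (a' j)) (g j) < η from hgE j)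
          obtain ⟨y, hy⟩ := lt_θ (a' j) c (4 * η) (by linarith)
          refine ⟨y, Or.inr ⟨hjV, Or.inr ?_⟩⟩
          have : k j = c := hkc
          rwa [this]
        · exact ⟨Classical.arbitrary Y, Or.inr ⟨hjV, Or.inl hj⟩⟩)
  have hx'V : ∀ j ∈ V, dist (ψ (x' j) (a' j)) c₀ < 4 * η := fun j hj => by
    rcases hx'U j with h | h
    · exact h.2
    · exact absurd hj h.1
  have hx'k : ∀ j ∉ V, good j → dist (ψ (x' j) (a' j)) (k j) < 4 * η := fun j hj hj' => by
    rcases hx'U j with h | h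
    · exact absurd h.1 hj
    · exact h.2.resolve_left fun h => h hj'
  have hgoodev : ∀ᶠ j in A'.F, good j := by
    have : ∀ᶠ j in A'.F, ∀ e, ¬ (∃ᶠ i in A'.F, g i = e) → g j ≠ e := by
      rw [eventually_all]
      intro e
      by_cases he : ∃ᶠ i in A'.F, g i = e
      · exact Eventually.of_forall fun j h => absurd he h
      · exact (not_frequently.1 he).mono fun j hj _ => hj
    filter_upwards [this] with j hj
    by_contra hj'
    exact hj (g j) hj' rfl
  refine ⟨x', hx', ?_, ?_, c₀, hc₀.mono fun j hj => by linarith,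
    mem_of_superset hVG fun j hj => (hx'V j hj).trans (by linarith)⟩
  · have hev : ∀ᶠ j in A.F, ∀ (e : E) (c : D),
        h j = c ∧ dist (θ (a j)) e < 2 * η → c ∈ Tv e := by
      rw [eventually_all]
      intro e
      rw [eventually_all]
      intro c
      by_cases hcT : c ∈ Tv e
      · exact Eventually.of_forall fun j _ => hcT
      · rw [hTv, not_frequently] at hcT
        exact hcT.mono fun j hj hj' => absurd hj' hj
    filter_upwards [h1, hev] with j hj hj2
    have : ∃ e : E, ∃ᶠ i in A'.F, g i = e ∧ dist (θ (a j)) (θ (a' i)) < η := by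
      by_contra! hne
      obtain ⟨i, hi, hi'⟩ := (hj.and_eventually (eventually_all.2 hne)).exists
      exact (hi' (g i)) rfl |>.not_gt hi
    obtain ⟨e, he⟩ := this
    have hej : dist (θ (a j)) e < 2 * η := by
      obtain ⟨i, rfl, hi⟩ := he.exists
      have e1 := dist_triangle (θ (a j)) (θ (a' i)) (g i)
      have e2 : dist (θ (a' i)) (g i) < η := hgE i
      linarith
    have hepos : ∃ᶠ i in A'.F, g i = e := he.mono fun i hi => hi.1
    refine ((hk e hepos).2 ⟨h j, (hh j).1⟩ (hj2 e _ ⟨rfl, hej⟩)).mono ?_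
    rintro i ⟨⟨rfl, hiV⟩, hki⟩
    have e1 : dist (ψ (x' i) (a' i)) (k i) < 4 * η := hx'k i hiV hepos
    have e2 : k i = h j := hki
    rw [e2] at e1
    have e3 := dist_triangle_right (ψ (x j) (a j)) (ψ (x' i) (a' i)) (h j)
    have e4 := (hh j).2
    linarith
  · filter_upwards [hgoodev] with i hi
    by_cases hiV : i ∈ V
    · refine (A.frequently_of_eventually hc₀).mono fun j hj => ?_
      have e1 := hx'V i hiV
      have e3 := dist_triangle_right (ψ (x j) (a j)) (ψ (x' i) (a' i)) c₀
      linarith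
    · have e1 := hx'k i hiV hi
      obtain ⟨c, hcT, hkc⟩ := (hk (g i) hi).1 i
      refine ((hTv _ _).1 hcT).mono ?_
      rintro j ⟨hj, -⟩
      have e2 : k i = h j := hkc.trans hj.symm
      rw [e2] at e1
      have e3 := dist_triangle_right (ψ (x j) (a j)) (ψ (x' i) (a' i)) (h j)
      have e4 := (hh j).2
      linarith

end Close

/-! ### Finite minima, finite nets, and comparison of suprema and infima -/

lemma exists_pos_le_of_fin {n : ℕ} {δ : Fin n → ℝ} (h : ∀ i, 0 < δ i) : ∃ η > 0, ∀ i, η ≤ δ i := by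
  induction n with
  | zero => exact ⟨1, one_pos, fun i => i.elim0⟩
  | succ n ih =>
    obtain ⟨η, hη, hη'⟩ := ih fun i => h i.succ
    refine ⟨min η (δ 0), lt_min hη (h 0), fun i => ?_⟩
    refine Fin.cases (min_le_right _ _) (fun i => (min_le_left _ _).trans (hη' i)) i

lemma exists_net {X : Type*} [PseudoMetricSpace X] {K : Set X} (hK : IsCompact K) {η : ℝ}
    (hη : 0 < η) : ∃ D : Finset X, ∀ x ∈ K, ∃ c ∈ D, dist x c < η := by
  obtain ⟨t, -, ht, hKt⟩ := hK.finite_cover_balls hη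
  refine ⟨ht.toFinset, fun x hx => ?_⟩
  obtain ⟨c, hc, hxc⟩ := Set.mem_iUnion₂.1 (hKt hx)
  exact ⟨c, by simpa using hc, hxc⟩

lemma abs_ciSup_sub_ciSup_le {ι κ : Type*} [Nonempty ι] [Nonempty κ] {f : ι → ℝ} {g : κ → ℝ}
    {ε : ℝ} (hf : BddAbove (Set.range f)) (hg : BddAbove (Set.range g))
    (h1 : ∀ i, ∃ k, |f i - g k| ≤ ε) (h2 : ∀ k, ∃ i, |f i - g k| ≤ ε) :
    |(⨆ i, f i) - ⨆ k, g k| ≤ ε := by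
  rw [abs_sub_le_iff]
  constructor
  · rw [sub_le_iff_le_add]
    refine ciSup_le fun i => ?_
    obtain ⟨k, hk⟩ := h1 i
    have := le_ciSup hg k
    have := (abs_le.1 hk).2
    linarith
  · rw [sub_le_iff_le_add]
    refine ciSup_le fun k => ?_
    obtain ⟨i, hi⟩ := h2 k
    have := le_ciSup hf i
    have := (abs_le.1 hi).1
    linarith

lemma abs_ciInf_sub_ciInf_le {ι κ : Type*} [Nonempty ι] [Nonempty κ] {f : ι → ℝ} {g : κ → ℝ}
    {ε : ℝ} (hf : BddBelow (Set.range f)) (hg : BddBelow (Set.range g))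
    (h1 : ∀ i, ∃ k, |f i - g k| ≤ ε) (h2 : ∀ k, ∃ i, |f i - g k| ≤ ε) :
    |(⨅ i, f i) - ⨅ k, g k| ≤ ε := by
  rw [abs_sub_le_iff]
  constructor
  · rw [sub_le_comm]
    refine le_ciInf fun k => ?_
    obtain ⟨i, hi⟩ := h2 k
    have := ciInf_le hf i
    have := (abs_le.1 hi).2
    linarith
  · rw [sub_le_comm]
    refine le_ciInf fun i => ?_
    obtain ⟨k, hk⟩ := h1 i
    have := ciInf_le hg k
    have := (abs_le.1 hk).1
    linarith

variable {L : MetricLanguage.{u}}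

lemma MetricStructure.continuous_rel (B : MetricStructure.{u, v} L) (R : L.Rel) :
    Continuous (B.rel R) := by
  rw [Metric.continuous_iff]
  intro x ε hε
  refine ⟨L.relMod R (ε / 2), L.relMod_pos R _ (half_pos hε), fun y hy => ?_⟩
  exact (B.rel_unif R y x (ε / 2) (half_pos hε) fun i =>
    (dist_le_pi_dist y x i).trans_lt hy).trans_lt (half_lt_self hε)

/-! ### Observables -/

/-- Uniformly continuous functions with relatively compact range on the tuples of `B`. -/
structure IsObservable (B : MetricStructure.{u, v} L) {Γ : List L.Sorts} {X : Type}
    [PseudoMetricSpace X] (ψ : Tuple B Γ → X) : Prop where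
  unif : ∀ ε > 0, ∃ δ > 0, ∀ a b : Tuple B Γ, (∀ S y, dist (a S y) (b S y) < δ) →
    dist (ψ a) (ψ b) ≤ ε
  compact : ∃ K, IsCompact K ∧ ∀ a, ψ a ∈ K

/-- A context has finitely many variables even if there are infinitely many sorts, so induction on
the context suffices. -/
lemma eventually_forall_sVar {J A : Type*} {Γ : List A} {F : Filter J}
    {P : ∀ S, SVar Γ S → J → Prop} (h : ∀ S y, ∀ᶠ j in F, P S y j) :
    ∀ᶠ j in F, ∀ S y, P S y j := by
  induction Γ with
  | nil => exact Eventually.of_forall fun j S y => nomatch y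
  | cons T Γ ih =>
    filter_upwards [h T .zero, ih (P := fun S y => P S y.succ) fun S y => h S y.succ] with j h1 h2
    intro S y
    cases y with
    | zero => exact h1
    | succ y => exact h2 S y

/-- The tuple of the values at `j` of a tuple of functions. -/
def tupleAt {B : MetricStructure.{u, v} L} {Γ : List L.Sorts} {J : Type} [TopologicalSpace J]
    (a : ∀ S, SVar Γ S → C(J, B.carrier S)) (j : J) : Tuple B Γ := fun S y => a S y j

/-- Adding a function in front of a tuple of functions. -/
def consFun {B : MetricStructure.{u, v} L} {Γ : List L.Sorts} {J : Type} [TopologicalSpace J]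
    {S : L.Sorts} (x : C(J, B.carrier S)) (a : ∀ S, SVar Γ S → C(J, B.carrier S)) :
    ∀ S', SVar (S :: Γ) S' → C(J, B.carrier S')
  | _, .zero => x
  | _, .succ y => a _ y

lemma tupleAt_consFun {B : MetricStructure.{u, v} L} {Γ : List L.Sorts} {J : Type}
    [TopologicalSpace J] {S : L.Sorts} (x : C(J, B.carrier S))
    (a : ∀ S, SVar Γ S → C(J, B.carrier S)) (j : J) :
    tupleAt (consFun x a) j = Tuple.cons (x j) (tupleAt a j) := by
  funext S y
  cases y <;> rfl

lemma IsObservable.continuous {B : MetricStructure.{u, v} L} {Γ : List L.Sorts} {X : Type}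
    [PseudoMetricSpace X] {ψ : Tuple B Γ → X} (h : IsObservable B ψ) {J : Type}
    [TopologicalSpace J] (a : ∀ S, SVar Γ S → C(J, B.carrier S)) :
    Continuous fun j => ψ (tupleAt a j) := by
  rw [continuous_iff_continuousAt]
  intro j
  rw [ContinuousAt, Metric.tendsto_nhds]
  intro ε hε
  obtain ⟨δ, hδ, hψ⟩ := h.unif (ε / 2) (half_pos hε)
  filter_upwards [eventually_forall_sVar fun S y =>
    Metric.tendsto_nhds.1 ((a S y).continuous.tendsto j) δ hδ] with i hi
  exact (hψ _ _ hi).trans_lt (half_lt_self hε)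

lemma dist_cons_lt {B : MetricStructure.{u, v} L} {Γ : List L.Sorts} {S : L.Sorts}
    (x : B.carrier S) {a b : Tuple B Γ} {δ : ℝ} (hδ : 0 < δ)
    (h : ∀ S y, dist (a S y) (b S y) < δ) (S') (y : SVar (S :: Γ) S') :
    dist (Tuple.cons x a S' y) (Tuple.cons x b S' y) < δ := by
  cases y with
  | zero => simpa [Tuple.cons] using hδ
  | succ y => exact h _ y

/-- The distances from the points of a finite set to the values that `ψ` takes when its first
variable varies. -/
lemma IsObservable.iInf_dist {B : MetricStructure.{u, v} L} {Γ : List L.Sorts} {S : L.Sorts}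
    {X : Type} [PseudoMetricSpace X] {ψ : Tuple B (S :: Γ) → X} (h : IsObservable B ψ)
    (D : Finset X) : IsObservable B fun (a : Tuple B Γ) (c : D) =>
      ⨅ x : B.carrier S, dist (ψ (Tuple.cons x a)) c := by
  have bdd : ∀ (a : Tuple B Γ) (c : D),
      BddBelow (Set.range fun x : B.carrier S => dist (ψ (Tuple.cons x a)) c) :=
    fun a c => ⟨0, by rintro _ ⟨x, rfl⟩; exact dist_nonneg⟩
  constructor
  · intro ε hε
    obtain ⟨δ, hδ, hψ⟩ := h.unif ε hε
    refine ⟨δ, hδ, fun a b hab => (dist_pi_le_iff hε.le).2 fun c => ?_⟩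
    have key : ∀ x : B.carrier S,
        |dist (ψ (Tuple.cons x a)) c - dist (ψ (Tuple.cons x b)) c| ≤ ε := fun x =>
      (abs_dist_sub_le _ _ _).trans (hψ _ _ (dist_cons_lt x hδ hab))
    exact abs_ciInf_sub_ciInf_le (bdd a c) (bdd b c) (fun x => ⟨x, key x⟩) fun x => ⟨x, key x⟩
  · obtain ⟨K, hK, hψK⟩ := h.compact
    have hC : ∀ c : D, ∃ C, ∀ x ∈ K, dist x c ≤ C := fun c =>
      let ⟨C, hC⟩ := hK.bddAbove_image (f := fun x => dist x (c : X))
        (continuous_id.dist continuous_const).continuousOn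
      ⟨C, fun x hx => hC ⟨x, hx, rfl⟩⟩
    choose C hC using hC
    refine ⟨Set.univ.pi fun c => Set.Icc 0 (C c), isCompact_univ_pi fun c => isCompact_Icc,
      fun a c _ => ⟨Real.iInf_nonneg fun x => dist_nonneg, ?_⟩⟩
    exact (ciInf_le (bdd a c) (Classical.arbitrary _)).trans (hC c _ (hψK _))

lemma IsObservable.pi {B : MetricStructure.{u, v} L} {Γ : List L.Sorts} {n : ℕ} {X : Fin n → Type}
    [∀ i, PseudoMetricSpace (X i)] {ψ : ∀ i, Tuple B Γ → X i} (h : ∀ i, IsObservable B (ψ i)) :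
    IsObservable B fun a i => ψ i a := by
  constructor
  · intro ε hε
    choose δ hδ hψ using fun i => (h i).unif ε hε
    obtain ⟨η, hη, hηδ⟩ := exists_pos_le_of_fin hδ
    exact ⟨η, hη, fun a b hab => (dist_pi_le_iff hε.le).2 fun i =>
      hψ i a b fun S y => (hab S y).trans_le (hηδ i)⟩
  · choose K hK hψ using fun i => (h i).compact
    exact ⟨Set.univ.pi K, isCompact_univ_pi hK, fun a i _ => hψ i a⟩

lemma STerm.unif (B : MetricStructure.{u, v} L) {Γ : List L.Sorts} {S : L.Sorts}
    (t : STerm L Γ S) : ∀ ε > 0, ∃ δ > 0, ∀ a b : Tuple B Γ, (∀ S y, dist (a S y) (b S y) < δ) →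
      dist (t.eval B a) (t.eval B b) < ε := by
  induction t with
  | var y => exact fun ε hε => ⟨ε, hε, fun a b h => h _ y⟩
  | app f t ih =>
    intro ε hε
    choose δ hδ h using fun i => ih i (L.funMod f (ε / 2)) (L.funMod_pos f _ (half_pos hε))
    obtain ⟨η, hη, hηδ⟩ := exists_pos_le_of_fin hδ
    exact ⟨η, hη, fun a b hab => (B.func_unif f _ _ (ε / 2) (half_pos hε) fun i =>
      h i a b fun S y => (hab S y).trans_le (hηδ i)).trans_lt (half_lt_self hε)⟩

lemma isObservable_dist (B : MetricStructure.{u, v} L) {Γ : List L.Sorts} {S : L.Sorts}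
    (s t : STerm L Γ S) : IsObservable B fun a => dist (s.eval B a) (t.eval B a) := by
  constructor
  · intro ε hε
    obtain ⟨δ, hδ, h⟩ := s.unif B (ε / 2) (half_pos hε)
    obtain ⟨δ', hδ', h'⟩ := t.unif B (ε / 2) (half_pos hε)
    refine ⟨min δ δ', lt_min hδ hδ', fun a b hab => ?_⟩
    have h1 := h a b fun S y => (hab S y).trans_le (min_le_left _ _)
    have h2 := h' a b fun S y => (hab S y).trans_le (min_le_right _ _)
    have := dist_dist_dist_le (s.eval B a) (t.eval B a) (s.eval B b) (t.eval B b)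
    linarith
  · exact ⟨Set.Icc 0 (L.diam S), isCompact_Icc, fun a => ⟨dist_nonneg, B.dist_le S _ _⟩⟩

lemma isObservable_rel (B : MetricStructure.{u, v} L) {Γ : List L.Sorts} (R : L.Rel)
    (t : ∀ i, STerm L Γ (L.relDom R i)) :
    IsObservable B fun a => B.rel R fun i => (t i).eval B a := by
  constructor
  · intro ε hε
    choose δ hδ h using fun i => (t i).unif B (L.relMod R ε) (L.relMod_pos R ε hε)
    obtain ⟨η, hη, hηδ⟩ := exists_pos_le_of_fin hδ
    exact ⟨η, hη, fun a b hab => B.rel_unif R _ _ ε hε fun i =>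
      h i a b fun S y => (hab S y).trans_le (hηδ i)⟩
  · exact ⟨Set.Icc (L.relLo R) (L.relHi R), isCompact_Icc, fun a => B.rel_mem R _⟩

/-! ### Bounds on formulas -/

/-- The bound does not depend on the structure. Thus one compact box serves both structures under
comparison, and the conditionally complete suprema and infima are never default values. -/
lemma SFormula.exists_bound {Γ : List L.Sorts} (φ : SFormula L Γ) :
    ∃ C, ∀ (M : MetricStructure.{u, v} L) (a : Tuple M Γ), |φ.eval M a| ≤ C := by
  induction φ with
  | @eqDist Γ S s t =>
    exact ⟨L.diam S, fun M a => (abs_of_nonneg dist_nonneg).trans_le (M.dist_le S _ _)⟩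
  | rel R t =>
    exact ⟨max |L.relLo R| |L.relHi R|, fun M a =>
      abs_le_max_abs_abs (M.rel_mem R _).1 (M.rel_mem R _).2⟩
  | conn n c φ ih =>
    choose C hC using ih
    obtain ⟨C', hC'⟩ := (isCompact_univ_pi fun i : Fin n =>
      isCompact_Icc (a := -C i) (b := C i)).exists_bound_of_continuousOn c.continuous.continuousOn
    exact ⟨C', fun M a => hC' _ fun i _ => abs_le.1 (hC i M a)⟩
  | sup S φ ih =>
    obtain ⟨C, hC⟩ := ih
    refine ⟨C, fun M a => abs_le.2 ⟨?_, ciSup_le fun x => (abs_le.1 (hC M _)).2⟩⟩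
    exact (abs_le.1 (hC M _)).1.trans (le_ciSup
      (f := fun x : M.carrier S => φ.eval M (Tuple.cons x a))
      ⟨C, by rintro _ ⟨x, rfl⟩; exact (abs_le.1 (hC M _)).2⟩ (Classical.arbitrary _))
  | inf S φ ih =>
    obtain ⟨C, hC⟩ := ih
    refine ⟨C, fun M a => abs_le.2 ⟨le_ciInf fun x => (abs_le.1 (hC M _)).1, ?_⟩⟩
    exact (ciInf_le (f := fun x : M.carrier S => φ.eval M (Tuple.cons x a))
      ⟨-C, by rintro _ ⟨x, rfl⟩; exact (abs_le.1 (hC M _)).1⟩ (Classical.arbitrary _)).trans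
      (abs_le.1 (hC M _)).2

lemma SFormula.bddAbove {Γ : List L.Sorts} {S : L.Sorts} (φ : SFormula L (S :: Γ))
    (M : MetricStructure.{u, v} L) (a : Tuple M Γ) :
    BddAbove (Set.range fun x : M.carrier S => φ.eval M (Tuple.cons x a)) :=
  let ⟨C, hC⟩ := φ.exists_bound
  ⟨C, by rintro _ ⟨x, rfl⟩; exact (abs_le.1 (hC M _)).2⟩

lemma SFormula.bddBelow {Γ : List L.Sorts} {S : L.Sorts} (φ : SFormula L (S :: Γ))
    (M : MetricStructure.{u, v} L) (a : Tuple M Γ) :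
    BddBelow (Set.range fun x : M.carrier S => φ.eval M (Tuple.cons x a)) :=
  let ⟨C, hC⟩ := φ.exists_bound
  ⟨-C, by rintro _ ⟨x, rfl⟩; exact (abs_le.1 (hC M _)).1⟩

/-! ### Essential suprema and powers over frames -/

/-- `v` is the essential supremum of `r` along `F`. -/
def IsEssSup {J : Type*} (F : Filter J) (r : J → ℝ) (v : ℝ) : Prop :=
  (∀ c, v < c → ∀ᶠ j in F, r j < c) ∧ ∀ c, c < v → ∃ᶠ j in F, c < r j

/-- A value of `r` above `v' + δ` taken positively often would have positively many values of `r'`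
above `v'` by a fixed margin. -/
lemma IsEssSup.le_add {J J' : Type*} {F : Filter J} {F' : Filter J'} {r : J → ℝ} {r' : J' → ℝ}
    {v v' δ : ℝ} (h : IsEssSup F r v) (h' : IsEssSup F' r' v')
    (hd : ∀ᶠ j in F, ∃ᶠ j' in F', dist (r j) (r' j') < δ) : v ≤ v' + δ := by
  by_contra! hlt
  obtain ⟨c, hc1, hc2⟩ := exists_between hlt
  obtain ⟨j, hj1, hj2⟩ := ((h.2 c hc2).and_eventually hd).exists
  obtain ⟨j', hj3, hj4⟩ := (hj2.and_eventually (h'.1 (c - δ) (by linarith))).exists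
  have := (abs_lt.1 hj3).2
  linarith

lemma IsEssSup.congr {J : Type*} {F : Filter J} {r r' : J → ℝ} {v : ℝ} (h : IsEssSup F r v)
    (hd : ∀ ε > 0, ∀ᶠ j in F, |r j - r' j| ≤ ε) : IsEssSup F r' v := by
  constructor
  · intro c hc
    obtain ⟨d, hd1, hd2⟩ := exists_between hc
    filter_upwards [h.1 d hd1, hd (c - d) (sub_pos.2 hd2)] with j h1 h2
    have := (abs_le.1 h2).1
    linarith
  · intro c hc
    obtain ⟨d, hd1, hd2⟩ := exists_between hc
    refine ((h.2 d hd2).and_eventually (hd (d - c) (sub_pos.2 hd1))).mono fun j hj => ?_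
    have := (abs_le.1 hj.2).2
    linarith [hj.1]

/-- The filter of the frame, or its ultrafilter. -/
def Frame.filter {J : Type} [TopologicalSpace J] (A : Frame J) : Bool → Filter J
  | true => A.F
  | false => A.G

/-- Along the filters `δ` is enough. Along the ultrafilters both functions are `δ`-near a common
point, hence within `2 * δ` of each other. -/
lemma Close.abs_sub_le {J J' : Type} [TopologicalSpace J] [TopologicalSpace J'] {A : Frame J}
    {A' : Frame J'} {r : J → ℝ} {r' : J' → ℝ} {δ v v' : ℝ} (h : Close A A' r r' δ) (b : Bool)
    (hv : IsEssSup (A.filter b) r v) (hv' : IsEssSup (A'.filter b) r' v') : |v - v'| ≤ 2 * δ := by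
  obtain ⟨h1, h2, c, h3, h4⟩ := h
  have hδ : 0 ≤ δ := dist_nonneg.trans h3.exists.choose_spec.le
  rw [abs_sub_le_iff]
  cases b with
  | true =>
    have e1 := hv.le_add hv' h1
    have e2 := hv'.le_add hv (h2.mono fun j' hj' => hj'.mono fun j hj => dist_comm (r j) _ ▸ hj)
    constructor <;> linarith
  | false =>
    have e : ∀ j j', dist (r j) c < δ → dist (r' j') c < δ → dist (r j) (r' j') < 2 * δ :=
      fun j j' hj hj' => by linarith [dist_triangle_right (r j) (r' j') c]
    have e1 := hv.le_add hv' (h3.mono fun j hj => (h4.mono fun j' => e j j' hj).frequently)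
    have e2 := hv'.le_add hv (h4.mono fun j' hj' =>
      (h3.mono fun j hj => (dist_comm _ _).trans_lt (e j j' hj hj')).frequently)
    constructor <;> linarith

/-- `N` is a power of `B` over the frame `A`: its elements are represented by continuous functions
on the frame, symbols are interpreted pointwise, and distances and relation symbols are essential
suprema along the filter or the ultrafilter of the frame, as prescribed by `gS` and `gR`. -/
structure IsPower (B : MetricStructure.{u, v} L) (gS : L.Sorts → Bool) (gR : L.Rel → Bool)
    {J : Type} [TopologicalSpace J] (A : Frame J) (N : MetricStructure.{u, v} L)
    (q : ∀ S, C(J, B.carrier S) → N.carrier S) : Prop where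
  surjective : ∀ S, Function.Surjective (q S)
  dist : ∀ S f g, IsEssSup (A.filter (gS S)) (fun j => dist (f j) (g j)) (dist (q S f) (q S g))
  func : ∀ f (x : ∀ i, C(J, B.carrier (L.funDom f i))) (y : C(J, B.carrier (L.funCod f))),
    (∀ j, y j = B.func f fun i => x i j) → N.func f (fun i => q _ (x i)) = q _ y
  rel : ∀ R (x : ∀ i, C(J, B.carrier (L.relDom R i))),
    IsEssSup (A.filter (gR R)) (fun j => B.rel R fun i => x i j) (N.rel R fun i => q _ (x i))

/-- Function symbols act pointwise and continuously on representatives, so terms do too. -/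
lemma IsPower.exists_eval {B : MetricStructure.{u, v} L} {gS : L.Sorts → Bool} {gR : L.Rel → Bool}
    {J : Type} [TopologicalSpace J] {A : Frame J} {N : MetricStructure.{u, v} L}
    {q : ∀ S, C(J, B.carrier S) → N.carrier S} (P : IsPower B gS gR A N q) {Γ : List L.Sorts}
    {S : L.Sorts} (t : STerm L Γ S) (a : ∀ S, SVar Γ S → C(J, B.carrier S)) :
    ∃ f : C(J, B.carrier S), (∀ j, f j = t.eval B (tupleAt a j)) ∧
      t.eval N (fun S y => q S (a S y)) = q S f := by
  induction t with
  | var y => exact ⟨a _ y, fun _ => rfl, rfl⟩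
  | app f t ih =>
    choose g hg hq using ih
    refine ⟨⟨fun j => B.func f fun i => g i j, (B.continuous_func f).comp
      (continuous_pi fun i => (g i).continuous)⟩, fun j => ?_, ?_⟩
    · simp only [ContinuousMap.coe_mk, hg]
      rfl
    · rw [← P.func f g _ fun j => rfl, STerm.eval]
      simp only [hq]

lemma q_cons {B N : MetricStructure.{u, v} L} {J : Type} [TopologicalSpace J] {Γ : List L.Sorts}
    {S : L.Sorts} (q : ∀ S, C(J, B.carrier S) → N.carrier S) (x : C(J, B.carrier S))
    (a : ∀ S, SVar Γ S → C(J, B.carrier S)) :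
    (Tuple.cons (q S x) fun S y => q S (a S y) : Tuple N (S :: Γ)) =
      fun S y => q S (consFun x a S y) := by
  funext S y
  cases y <;> rfl

/-! ### Formulas are controlled by observables -/

/-- The conclusion of the comparison theorem, for one formula. -/
def SFormula.IsControlled (B : MetricStructure.{u, v} L) (gS : L.Sorts → Bool)
    (gR : L.Rel → Bool) {Γ : List L.Sorts} (φ : SFormula L Γ) : Prop :=
  ∀ ε > 0, ∃ (X : Type) (_ : PseudoMetricSpace X) (ψ : Tuple B Γ → X), IsObservable B ψ ∧
    ∃ δ > 0, ∀ (J J' : Type) [TopologicalSpace J] [TopologicalSpace J'] (A : Frame J)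
      (A' : Frame J') (N N' : MetricStructure.{u, v} L)
      (q : ∀ S, C(J, B.carrier S) → N.carrier S) (q' : ∀ S, C(J', B.carrier S) → N'.carrier S),
      IsPower B gS gR A N q → IsPower B gS gR A' N' q' →
      ∀ (a : ∀ S, SVar Γ S → C(J, B.carrier S)) (a' : ∀ S, SVar Γ S → C(J', B.carrier S)),
      Close A A' (fun j => ψ (tupleAt a j)) (fun j => ψ (tupleAt a' j)) δ →
      |φ.eval N (fun S y => q S (a S y)) - φ.eval N' (fun S y => q' S (a' S y))| ≤ ε

/-- Back and forth along one quantifier. -/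
lemma IsObservable.exists_extension {B : MetricStructure.{u, v} L} {Γ : List L.Sorts} {S : L.Sorts}
    {X : Type} [PseudoMetricSpace X] {ψ : Tuple B (S :: Γ) → X} (h : IsObservable B ψ) {δ : ℝ}
    (hδ : 0 < δ) : ∃ (X' : Type) (_ : PseudoMetricSpace X') (ψ' : Tuple B Γ → X'),
      IsObservable B ψ' ∧ ∃ δ' > 0,
      ∀ (J J' : Type) [TopologicalSpace J] [TopologicalSpace J'] (A : Frame J) (A' : Frame J')
      (a : ∀ S, SVar Γ S → C(J, B.carrier S)) (a' : ∀ S, SVar Γ S → C(J', B.carrier S)),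
      Close A A' (fun j => ψ' (tupleAt a j)) (fun j => ψ' (tupleAt a' j)) δ' →
      ∀ x : C(J, B.carrier S), ∃ x' : C(J', B.carrier S),
        Close A A' (fun j => ψ (tupleAt (consFun x a) j)) (fun j => ψ (tupleAt (consFun x' a') j))
          δ := by
  obtain ⟨K, hK, hψK⟩ := h.compact
  -- The division by 5 absorbs the loss in `Close.exists_extension`.
  obtain ⟨D, hD⟩ := exists_net hK (η := δ / 5) (by positivity)
  have hθ := h.iInf_dist D
  obtain ⟨K', hK', hθK'⟩ := hθ.compact
  obtain ⟨E, hE⟩ := exists_net hK' (η := δ / 5) (by positivity)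
  refine ⟨_, _, _, hθ, δ / 5, by positivity, fun J J' _ _ A A' a a' hclose x => ?_⟩
  obtain ⟨x', hx', hx'c⟩ := hclose.exists_extension
    (ψ := fun (x : B.carrier S) (t : Tuple B Γ) => ψ (Tuple.cons x t)) (by positivity)
    (fun y t => hD _ (hψK _)) ⟨E, fun t => hE _ (hθK' t)⟩
    (fun y => by
      simpa only [tupleAt_consFun, ContinuousMap.const_apply] using h.continuous (consFun (ContinuousMap.const J' y) a'))
    (hθ.continuous a') x
  refine ⟨⟨x', hx'.continuous⟩, ?_⟩
  simp only [tupleAt_consFun]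
  rwa [mul_div_cancel₀ δ (by norm_num : (5 : ℝ) ≠ 0)] at hx'c

lemma isControlled_eqDist (B : MetricStructure.{u, v} L) (gS : L.Sorts → Bool) (gR : L.Rel → Bool)
    {Γ : List L.Sorts} {S : L.Sorts} (s t : STerm L Γ S) :
    (SFormula.eqDist s t).IsControlled B gS gR := by
  intro ε hε
  refine ⟨ℝ, _, _, isObservable_dist B s t, ε / 2, half_pos hε, ?_⟩
  intro J J' _ _ A A' N N' q q' P P' a a' hc
  obtain ⟨f, hf, hqf⟩ := P.exists_eval s a
  obtain ⟨g, hg, hqg⟩ := P.exists_eval t a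
  obtain ⟨f', hf', hqf'⟩ := P'.exists_eval s a'
  obtain ⟨g', hg', hqg'⟩ := P'.exists_eval t a'
  simp only [SFormula.eval, hqf, hqg, hqf', hqg']
  simp only [← hf, ← hg, ← hf', ← hg'] at hc
  refine (hc.abs_sub_le (gS S) (P.dist S f g) (P'.dist S f' g')).trans ?_
  linarith

lemma isControlled_rel (B : MetricStructure.{u, v} L) (gS : L.Sorts → Bool) (gR : L.Rel → Bool)
    {Γ : List L.Sorts} (R : L.Rel) (t : ∀ i, STerm L Γ (L.relDom R i)) :
    (SFormula.rel R t).IsControlled B gS gR := by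
  intro ε hε
  refine ⟨ℝ, _, _, isObservable_rel B R t, ε / 2, half_pos hε, ?_⟩
  intro J J' _ _ A A' N N' q q' P P' a a' hc
  choose f hf hqf using fun i => P.exists_eval (t i) a
  choose f' hf' hqf' using fun i => P'.exists_eval (t i) a'
  simp only [SFormula.eval, hqf, hqf']
  simp only [← hf, ← hf'] at hc
  refine (hc.abs_sub_le (gR R) (P.rel R f) (P'.rel R f')).trans ?_
  linarith

/-- The connective is uniformly continuous on the box of possible values, and the product of the
observables controls all arguments at once. -/
lemma isControlled_conn (B : MetricStructure.{u, v} L) (gS : L.Sorts → Bool) (gR : L.Rel → Bool)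
    {Γ : List L.Sorts} (n : ℕ) (c : C(Fin n → ℝ, ℝ)) (φ : Fin n → SFormula L Γ)
    (h : ∀ i, (φ i).IsControlled B gS gR) : (SFormula.conn n c φ).IsControlled B gS gR := by
  intro ε hε
  choose C hC using fun i => (φ i).exists_bound
  have hbox := isCompact_univ_pi fun i : Fin n => isCompact_Icc (a := -C i) (b := C i)
  obtain ⟨δ, hδ, hcδ⟩ := Metric.uniformContinuousOn_iff_le.1
    (hbox.uniformContinuousOn_of_continuous c.continuous.continuousOn) ε hε
  choose X inst ψ hψ η hη hclose using fun i => h i δ hδ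
  obtain ⟨η', hη', hle⟩ := exists_pos_le_of_fin hη
  refine ⟨∀ i, X i, _, _, IsObservable.pi hψ, η', hη', ?_⟩
  intro J J' _ _ A A' N N' q q' P P' a a' hc
  refine hcδ _ (fun i _ => abs_le.1 (hC i _ _)) _ (fun i _ => abs_le.1 (hC i _ _))
    ((dist_pi_le_iff hδ.le).2 fun i => ?_)
  exact hclose i J J' A A' N N' q q' P P' a a'
    (hc.map (fun x => x i) (fun x y => dist_le_pi_dist x y i) (hle i))

/-- The value of a formula in a power over a frame is determined, up to a small error, by the
essential range and the limit of an observable. -/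
theorem SFormula.isControlled (B : MetricStructure.{u, v} L) (gS : L.Sorts → Bool)
    (gR : L.Rel → Bool) {Γ : List L.Sorts} (φ : SFormula L Γ) : φ.IsControlled B gS gR := by
  induction φ with
  | eqDist s t => exact isControlled_eqDist B gS gR s t
  | rel R t => exact isControlled_rel B gS gR R t
  | conn n c φ ih => exact isControlled_conn B gS gR n c φ ih
  | sup S φ ih =>
    intro ε hε
    obtain ⟨X, _, ψ, hψ, δ, hδ, h⟩ := ih ε hε
    obtain ⟨X', _, ψ', hψ', δ', hδ', h'⟩ := hψ.exists_extension hδ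
    refine ⟨X', _, ψ', hψ', δ', hδ', ?_⟩
    intro J J' _ _ A A' N N' q q' P P' a a' hc
    -- Every element of either structure has a partner in the other with nearly the same value of
    -- `φ`; the two directions use the symmetry of `Close`.
    refine abs_ciSup_sub_ciSup_le (φ.bddAbove N _) (φ.bddAbove N' _) (fun x => ?_) fun x' => ?_
    · obtain ⟨x, rfl⟩ := P.surjective S x
      obtain ⟨x', hx'⟩ := h' J J' A A' a a' hc x
      exact ⟨q' S x', by simpa only [q_cons] using h J J' A A' N N' q q' P P' _ _ hx'⟩
    · obtain ⟨x', rfl⟩ := P'.surjective S x'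
      obtain ⟨x, hx⟩ := h' J' J A' A a' a hc.symm x'
      exact ⟨q S x, by simpa only [q_cons] using h J J' A A' N N' q q' P P' _ _ hx.symm⟩
  | inf S φ ih =>
    intro ε hε
    obtain ⟨X, _, ψ, hψ, δ, hδ, h⟩ := ih ε hε
    obtain ⟨X', _, ψ', hψ', δ', hδ', h'⟩ := hψ.exists_extension hδ
    refine ⟨X', _, ψ', hψ', δ', hδ', ?_⟩
    intro J J' _ _ A A' N N' q q' P P' a a' hc
    refine abs_ciInf_sub_ciInf_le (φ.bddBelow N _) (φ.bddBelow N' _) (fun x => ?_) fun x' => ?_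
    · obtain ⟨x, rfl⟩ := P.surjective S x
      obtain ⟨x', hx'⟩ := h' J J' A A' a a' hc x
      exact ⟨q' S x', by simpa only [q_cons] using h J J' A A' N N' q q' P P' _ _ hx'⟩
    · obtain ⟨x', rfl⟩ := P'.surjective S x'
      obtain ⟨x, hx⟩ := h' J' J A' A a' a hc.symm x'
      exact ⟨q S x, by simpa only [q_cons] using h J J' A A' N N' q q' P P' _ _ hx.symm⟩

/-- Composition with a map of frames that preserves essential ranges and limits of continuous
functions is an elementary embedding. -/
theorem isElementaryEmbedding_of_comp {B N N' : MetricStructure.{u, v} L} {gS : L.Sorts → Bool}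
    {gR : L.Rel → Bool} {J J' : Type} [TopologicalSpace J] [TopologicalSpace J'] {A : Frame J}
    {A' : Frame J'} {q : ∀ S, C(J, B.carrier S) → N.carrier S}
    {q' : ∀ S, C(J', B.carrier S) → N'.carrier S} (P : IsPower B gS gR A N q)
    (P' : IsPower B gS gR A' N' q') (β : C(J', J))
    (hβ : ∀ (X : Type) [PseudoMetricSpace X] (r : J → X), Continuous r → ∀ δ > 0,
      Close A A' r (fun j => r (β j)) δ) (Φ : SortedMap N N')
    (hΦ : ∀ S f, Φ S (q S f) = q' S (f.comp β)) : IsElementaryEmbedding Φ := by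
  -- Closeness for every `δ` forces equal essential suprema. This settles distances and relation
  -- symbols.
  have eq_of : ∀ (r : J → ℝ) (b : Bool) (v v' : ℝ), Continuous r → IsEssSup (A.filter b) r v →
      IsEssSup (A'.filter b) (fun j => r (β j)) v' → v' = v := by
    intro r b v v' hr hv hv'
    refine (eq_of_abs_sub_nonpos (le_of_forall_pos_le_add fun ε hε => ?_)).symm
    have := (hβ ℝ r hr (ε / 2) (half_pos hε)).abs_sub_le b hv hv'
    linarith
  refine ⟨⟨fun S => Isometry.of_dist_eq fun x y => ?_, fun f x => ?_, fun R x => ?_⟩,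
    fun Γ φ a => ?_⟩
  · obtain ⟨x, rfl⟩ := P.surjective S x
    obtain ⟨y, rfl⟩ := P.surjective S y
    rw [hΦ, hΦ]
    exact eq_of _ _ _ _ (x.continuous.dist y.continuous) (P.dist S x y)
      (P'.dist S (x.comp β) (y.comp β))
  · choose y hy using fun i => P.surjective _ (x i)
    obtain rfl : (fun i => q _ (y i)) = x := funext hy
    have hc : Continuous fun j => B.func f fun i => y i j :=
      (B.continuous_func f).comp (continuous_pi fun i => (y i).continuous)
    rw [P.func f y ⟨_, hc⟩ fun j => rfl, hΦ]
    simp only [hΦ]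
    exact (P'.func f (fun i => (y i).comp β) _ fun j => rfl).symm
  · choose y hy using fun i => P.surjective _ (x i)
    obtain rfl : (fun i => q _ (y i)) = x := funext hy
    simp only [hΦ]
    have hc : Continuous fun j => B.rel R fun i => y i j :=
      (B.continuous_rel R).comp (continuous_pi fun i => (y i).continuous)
    exact eq_of _ _ _ _ hc (P.rel R y) (P'.rel R fun i => (y i).comp β)
  · choose b hb using fun S (y : SVar Γ S) => P.surjective S (a S y)
    obtain rfl : (fun S y => q S (b S y)) = a := funext fun S => funext fun y => hb S y
    simp only [hΦ]
    refine (eq_of_abs_sub_nonpos (le_of_forall_pos_le_add fun ε hε => ?_)).symm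
    obtain ⟨X, _, ψ, hψ, δ, hδ, h⟩ := φ.isControlled B gS gR ε hε
    rw [zero_add]
    exact h J J' A A' N N' q q' P P' b (fun S y => (b S y).comp β)
      (hβ X _ (hψ.continuous b) δ hδ)

/-! ### The dual filter of an ideal and reduced powers -/

/-- The filter of the complements of the sets in the ideal `I`. -/
def idealFilter (I : Order.Ideal (Set ℕ)) : Filter ℕ where
  sets := {X | Xᶜ ∈ I}
  univ_sets := by
    rw [Set.mem_ofPred_eq, Set.compl_univ]
    exact I.bot_mem
  sets_of_superset := fun h hXY => I.lower (Set.compl_subset_compl.2 hXY) h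
  inter_sets := fun {X Y} hX hY => by
    rw [Set.mem_ofPred_eq, Set.compl_inter]
    exact I.sup_mem hX hY

lemma mem_idealFilter {I : Order.Ideal (Set ℕ)} {X : Set ℕ} : X ∈ idealFilter I ↔ Xᶜ ∈ I := Iff.rfl

lemma eventually_idealFilter {I : Order.Ideal (Set ℕ)} {P : ℕ → Prop} :
    (∀ᶠ j in idealFilter I, P j) ↔ {j | ¬ P j} ∈ I := Iff.rfl

lemma frequently_idealFilter {I : Order.Ideal (Set ℕ)} {P : ℕ → Prop} :
    (∃ᶠ j in idealFilter I, P j) ↔ {j | P j} ∉ I := by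
  rw [Filter.Frequently, eventually_idealFilter]
  simp only [not_not]

lemma idealFilter_dualIdeal (U : Ultrafilter ℕ) : idealFilter (dualIdeal U) = U := by
  ext X
  rw [mem_idealFilter]
  exact (Ultrafilter.compl_notMem_iff (f := U) (s := X))

lemma univ_notMem (I : Order.Ideal (Set ℕ)) [hI : I.IsProper] : (Set.univ : Set ℕ) ∉ I := fun h =>
  hI.ne_univ (Set.eq_univ_of_forall fun Y => I.lower (Set.subset_univ Y) h)

instance (I : Order.Ideal (Set ℕ)) [I.IsProper] : (idealFilter I).NeBot := by
  refine ⟨fun h => univ_notMem I ?_⟩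
  have : (∅ : Set ℕ) ∈ idealFilter I := h ▸ mem_bot
  rwa [mem_idealFilter, Set.compl_empty] at this

/-- The lower bound `lo` makes the infimum in `limsupMod` a genuine one. -/
lemma isEssSup_limsupMod {I : Order.Ideal (Set ℕ)} [I.IsProper] {r : ℕ → ℝ} {lo : ℝ}
    (hlo : ∀ j, lo ≤ r j) (hbdd : BddAbove (Set.range r)) :
    IsEssSup (idealFilter I) r (limsupMod I r) := by
  constructor
  · intro c hc
    obtain ⟨X, hX, h⟩ := exists_of_limsupMod_lt hbdd hc
    refine eventually_idealFilter.2 (I.lower (fun j hj => ?_) hX)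
    by_contra hjX
    exact hj (h j hjX)
  · intro c hc
    rw [frequently_idealFilter]
    intro h
    refine hc.not_ge (limsupMod_le hlo hbdd h fun j hj => ?_)
    simpa using hj

section RedPower

variable (I : Order.Ideal (Set ℕ)) [I.IsProper] (B : MetricStructure.{u, v} L)

/-- The chosen representative is at distance zero from `a`. It need not agree with `a` modulo the
ideal, only be eventually within each `δ`. -/
lemma eventually_dist_rep_mk {S : L.Sorts} (a : ℕ → B.carrier S) {δ : ℝ} (hδ : 0 < δ) :
    ∀ᶠ j in idealFilter I, dist (RepSeq.rep (RepSeq.mk I B a) j) (a j) < δ := by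
  have h0 : dist (RepSeq.rep (RepSeq.mk I B a)) (show RepSeq I B S from a) < δ := by
    rw [Metric.inseparable_iff.1 (SeparationQuotient.mk_eq_mk.1 (RepSeq.mk_rep _))]
    exact hδ
  obtain ⟨X, hX, h⟩ := RepSeq.exists_of_dist_lt h0
  refine eventually_idealFilter.2 (I.lower (fun j hj => ?_) hX)
  by_contra hjX
  exact hj (h j hjX)

lemma RedPower.isEssSup_dist {S : L.Sorts} (a b : ℕ → B.carrier S) :
    IsEssSup (idealFilter I) (fun j => dist (a j) (b j))
      (dist (RepSeq.mk I B a) (RepSeq.mk I B b)) :=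
  isEssSup_limsupMod (fun _ => dist_nonneg) (bddAbove_dist B a b)

lemma RedPower.func_mk (f : L.Func) (a : ∀ i, ℕ → B.carrier (L.funDom f i)) :
    (RedPower I B).func f (fun i => RepSeq.mk I B (a i)) =
      RepSeq.mk I B fun j => B.func f fun i => a i j := by
  refine SeparationQuotient.mk_eq_mk.2 (Metric.inseparable_iff.2
    (le_antisymm (le_of_forall_pos_le_add fun ε hε => ?_) dist_nonneg))
  have h := eventually_all.2 fun i =>
    eventually_dist_rep_mk I B (a i) (L.funMod_pos f ε hε)
  rw [zero_add]
  refine RepSeq.dist_le (eventually_idealFilter.1 h) fun j hj => ?_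
  exact B.func_unif f _ _ ε hε (not_not.1 hj)

lemma RedPower.isEssSup_rel (R : L.Rel) (a : ∀ i, ℕ → B.carrier (L.relDom R i)) :
    IsEssSup (idealFilter I) (fun j => B.rel R fun i => a i j)
      ((RedPower I B).rel R fun i => RepSeq.mk I B (a i)) := by
  have h : IsEssSup (idealFilter I) (fun j => B.rel R fun i => RepSeq.rep (RepSeq.mk I B (a i)) j)
      ((RedPower I B).rel R fun i => RepSeq.mk I B (a i)) :=
    isEssSup_limsupMod (fun j => (B.rel_mem R _).1) (B.bddAbove_rel R _)
  refine h.congr fun ε hε => ?_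
  filter_upwards [eventually_all.2 fun i =>
    eventually_dist_rep_mk I B (a i) (L.relMod_pos R ε hε)] with j hj
  exact B.rel_unif R _ _ ε hε hj

end RedPower

/-! ### The Cantor space -/

lemma isEssSup_top {J : Type*} [Nonempty J] {r : J → ℝ} (h : BddAbove (Set.range r)) :
    IsEssSup ⊤ r (⨆ j, r j) := by
  constructor
  · intro c hc
    exact eventually_top.2 fun j => (le_ciSup h j).trans_lt hc
  · intro c hc
    exact frequently_top.2 (exists_lt_of_lt_ciSup hc)

lemma isEssSup_pure {J : Type*} (p : J) (r : J → ℝ) :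
    IsEssSup ((pure p : Ultrafilter J) : Filter J) r (r p) := by
  constructor <;> intro c hc
  · simpa using hc
  · rw [Ultrafilter.frequently_iff_eventually]
    simpa using hc

lemma initSeg_eq_iff {x y : Cantor} {n : ℕ} :
    initSeg x n = initSeg y n ↔ ∀ i < n, x i = y i := by
  rw [initSeg, initSeg, List.ofFn_inj, funext_iff]
  exact ⟨fun h i hi => h ⟨i, hi⟩, fun h i => h i i.2⟩

lemma initSeg_succ (x : Cantor) (n : ℕ) : initSeg x (n + 1) = initSeg x n ++ [x n] := by
  rw [initSeg, List.ofFn_succ', List.concat_eq_append]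
  rfl

lemma initSeg_mono {x y : Cantor} {m n : ℕ} (hmn : m ≤ n) (h : initSeg x n = initSeg y n) :
    initSeg x m = initSeg y m := by
  rw [initSeg_eq_iff] at h ⊢
  exact fun i hi => h i (hi.trans_le hmn)

lemma exists_initSeg_subset {V : Set Cantor} {x : Cantor} (hV : V ∈ 𝓝 x) :
    ∃ n, ∀ y, initSeg y n = initSeg x n → y ∈ V := by
  obtain ⟨_, ⟨z, n, rfl⟩, hx, hzV⟩ :=
    (PiNat.isTopologicalBasis_cylinders fun _ : ℕ => Bool).mem_nhds_iff.1 hV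
  refine ⟨n, fun y hy => hzV ?_⟩
  rw [PiNat.mem_cylinder_iff] at hx ⊢
  exact fun i hi => (initSeg_eq_iff.1 hy i hi).trans (hx i hi)

lemma isOpen_setOf_initSeg (x : Cantor) (n : ℕ) : IsOpen {y | initSeg y n = initSeg x n} := by
  convert PiNat.isOpen_cylinder (fun _ : ℕ => Bool) x n using 1
  ext y
  rw [PiNat.mem_cylinder_iff, Set.mem_ofPred_eq, initSeg_eq_iff]

lemma isLocallyConstant_initSeg (n : ℕ) : IsLocallyConstant fun x : Cantor => initSeg x n := by
  rw [IsLocallyConstant.iff_eventually_eq]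
  exact fun x => (isOpen_setOf_initSeg x n).mem_nhds rfl

/-- Compactness: finitely many cylinders that refine the cover also cover `K`, and the largest of
their lengths works everywhere. -/
lemma exists_level {ι : Type*} (U : ι → Set Cantor) (hU : ∀ i, IsOpen (U i))
    (hc : ∀ x, ∃ i, x ∈ U i) : ∃ n, ∀ x, ∃ i, ∀ y, initSeg y n = initSeg x n → y ∈ U i := by
  have : ∃ n, ∀ x ∈ (Set.univ : Set Cantor), ∃ i, ∀ y, initSeg y n = initSeg x n → y ∈ U i := by
    refine isCompact_univ.induction_on (p := fun s => ∃ n, ∀ x ∈ s, ∃ i, ∀ y,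
      initSeg y n = initSeg x n → y ∈ U i) ⟨0, by simp⟩ ?_ ?_ ?_
    · rintro s t hst ⟨n, hn⟩
      exact ⟨n, fun x hx => hn x (hst hx)⟩
    · rintro s t ⟨m, hm⟩ ⟨n, hn⟩
      refine ⟨max m n, ?_⟩
      rintro x (hx | hx)
      · obtain ⟨i, hi⟩ := hm x hx
        exact ⟨i, fun y hy => hi y (initSeg_mono (le_max_left _ _) hy)⟩
      · obtain ⟨i, hi⟩ := hn x hx
        exact ⟨i, fun y hy => hi y (initSeg_mono (le_max_right _ _) hy)⟩
    · intro x _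
      obtain ⟨i, hi⟩ := hc x
      obtain ⟨n, hn⟩ := exists_initSeg_subset ((hU i).mem_nhds hi)
      exact ⟨_, mem_nhdsWithin_of_mem_nhds ((isOpen_setOf_initSeg x n).mem_nhds rfl), n,
        fun y hy => ⟨i, fun z hz => hn z (hz.trans hy)⟩⟩
  exact this.imp fun n hn x => hn x trivial

/-- The point that agrees with `x` on the first `n` coordinates and vanishes afterwards. -/
def truncate (n : ℕ) (x : Cantor) : Cantor := fun i => if i < n then x i else false

lemma initSeg_truncate (n : ℕ) (x : Cantor) : initSeg (truncate n x) n = initSeg x n :=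
  initSeg_eq_iff.2 fun _ hi => if_pos hi

lemma truncate_eq {n : ℕ} {x y : Cantor} (h : initSeg x n = initSeg y n) :
    truncate n x = truncate n y := by
  funext i
  unfold truncate
  split_ifs with hi
  · exact initSeg_eq_iff.1 h i hi
  · rfl

lemma isLocallyConstant_truncate (n : ℕ) : IsLocallyConstant (truncate n) := by
  rw [IsLocallyConstant.iff_eventually_eq]
  exact fun x => ((isLocallyConstant_initSeg n).eventually_eq x).mono fun y => truncate_eq

/-- The functions that depend on finitely many coordinates are dense. -/
lemma dense_finite_dependence (X : Type*) [MetricSpace X] :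
    Dense {f : C(Cantor, X) | ∃ n, ∀ x y, initSeg x n = initSeg y n → f x = f y} := by
  rw [Metric.dense_iff]
  intro f ε hε
  obtain ⟨n, hn⟩ := exists_level (fun x => {y | dist (f y) (f x) < ε / 4})
    (fun x => isOpen_lt (f.continuous.dist continuous_const) continuous_const)
    fun x => ⟨x, by simpa using hε⟩
  refine ⟨f.comp ⟨truncate n, (isLocallyConstant_truncate n).continuous⟩, ?_, n,
    fun x y hxy => congrArg f (truncate_eq hxy)⟩
  rw [Metric.mem_ball]
  refine lt_of_le_of_lt ((ContinuousMap.dist_le (half_pos hε).le).2 fun x => ?_) (half_lt_self hε)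
  obtain ⟨z, hz⟩ := hn x
  have e1 : dist (f (truncate n x)) (f z) < ε / 4 := hz _ (initSeg_truncate n x)
  have e2 : dist (f x) (f z) < ε / 4 := hz x rfl
  have e3 := dist_triangle_right (f (truncate n x)) (f x) (f z)
  change dist (f (truncate n x)) (f x) ≤ _
  linarith

/-- The Cantor space with the filter of all sets and a principal ultrafilter. -/
def cantorFrame (p : Cantor) : Frame Cantor where
  F := ⊤
  G := pure p
  le := le_top
  exists_refinement 𝒰 h𝒰 hc := by
    obtain ⟨n, hn⟩ := exists_level (fun U : 𝒰 => U.1) (fun U => h𝒰 _ U.2) fun x =>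
      let ⟨U, hU, hx⟩ := hc x
      ⟨⟨U, hU⟩, hx⟩
    choose k hk using hn
    refine ⟨fun x => k (truncate n x), (isLocallyConstant_truncate n).comp fun x => (k x : Set Cantor),
      fun x => ⟨(k _).2, hk _ _ (initSeg_truncate n x).symm⟩⟩
  split Z hZ hne := by
    obtain ⟨x, hx⟩ := frequently_top.1 hne
    obtain ⟨n, hn⟩ := exists_initSeg_subset (hZ.isOpen.mem_nhds hx)
    -- One more coordinate than `n` is fixed, so flipping coordinate `n` of `x` stays in `Z` but
    -- leaves the smaller cylinder.
    refine ⟨{y | initSeg y (n + 1) = initSeg x (n + 1)},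
      (isLocallyConstant_initSeg (n + 1)).isClopen_fiber _,
      frequently_top.2 ⟨x, hx, rfl⟩,
      frequently_top.2 ⟨Function.update x n (!x n), hn _ ?_, fun h => ?_⟩⟩
    · exact initSeg_eq_iff.2 fun i hi => Function.update_of_ne hi.ne _ _
    · have := initSeg_eq_iff.1 h n n.lt_succ_self
      simp at this

section KStr

variable (B : MetricStructure.{u, v} L)

lemma KStr.isEssSup_dist {S : L.Sorts} (f g : C(Cantor, B.carrier S)) :
    IsEssSup ⊤ (fun x => dist (f x) (g x)) (dist f g) := by
  rw [ContinuousMap.dist_eq_iSup]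
  exact isEssSup_top ⟨L.diam S, by rintro _ ⟨x, rfl⟩; exact B.dist_le S _ _⟩

lemma KStr.isEssSup_rel (R : L.Rel) (a : ∀ i, C(Cantor, B.carrier (L.relDom R i))) :
    IsEssSup ⊤ (fun x => B.rel R fun i => a i x) ((KStr B).rel R a) :=
  isEssSup_top (B.bddAbove_rel R _)

lemma isPower_KStr (p : Cantor) : IsPower B (fun _ => true) (fun _ => true) (cantorFrame p)
    (KStr B) (fun _ f => f) where
  surjective _ f := ⟨f, rfl⟩
  dist _ f g := KStr.isEssSup_dist B f g
  func _ _ _ hy := ContinuousMap.ext fun j => (hy j).symm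
  rel R x := KStr.isEssSup_rel B R x

end KStr

/-! ### The frame of an atomless ideal -/

lemma IsAtomless.exists_split {I : Order.Ideal (Set ℕ)} (hI : IsAtomless I) {X : Set ℕ}
    (hX : X ∉ I) : ∃ Y ⊆ X, Y ∉ I ∧ X \ Y ∉ I := by
  have h := hI (QuotientAlgebra.mk I X)
  have hmk : ∀ {Y Z : Set ℕ}, QuotientAlgebra.mk I Y ≤ QuotientAlgebra.mk I Z ↔ Y \ Z ∈ I :=
    Iff.rfl
  have hbot : ∀ {Y : Set ℕ}, QuotientAlgebra.mk I Y = ⊥ ↔ Y ∈ I := by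
    intro Y
    rw [← le_bot_iff]
    change Y \ ∅ ∈ I ↔ _
    rw [Set.sdiff_empty]
  rw [IsAtom, not_and_or, not_not, hbot] at h
  have h := h.resolve_left hX
  push Not at h
  obtain ⟨b, hb1, hb2⟩ := h
  obtain ⟨Y, rfl⟩ : ∃ Y, QuotientAlgebra.mk I Y = b := Quotient.exists_rep b
  rw [lt_iff_le_not_ge, hmk, hmk] at hb1
  rw [Ne, hbot] at hb2
  -- `Y` lies below `X` only modulo the ideal, hence the intersection.
  refine ⟨X ∩ Y, Set.inter_subset_left, fun h => hb2 ?_, fun h => hb1.2 ?_⟩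
  · refine I.lower ?_ (I.sup_mem h hb1.1)
    intro j hj
    by_cases hjX : j ∈ X
    · exact Or.inl ⟨hjX, hj⟩
    · exact Or.inr ⟨hj, hjX⟩
  · rwa [Set.sdiff_self_inter] at h

/-- The discrete frame of an atomless ideal and an ultrafilter disjoint from it. -/
def idealFrame {I : Order.Ideal (Set ℕ)} (hI : IsAtomless I) (U : Ultrafilter ℕ)
    (hU : (U : Filter ℕ) ≤ idealFilter I) : Frame ℕ where
  F := idealFilter I
  G := U
  le := hU
  exists_refinement 𝒰 _ hc := by
    choose k hk using hc
    exact ⟨k, IsLocallyConstant.of_discrete k, hk⟩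
  split Z _ hZ := by
    obtain ⟨Y, hYZ, hY, hZY⟩ := hI.exists_split (frequently_idealFilter.1 hZ)
    refine ⟨Y, isClopen_discrete Y, frequently_idealFilter.2 ?_, frequently_idealFilter.2 hZY⟩
    rwa [show {j | j ∈ Z ∧ j ∈ Y} = Y from Set.inter_eq_self_of_subset_right hYZ]

lemma isPower_RedPower (B : MetricStructure.{u, v} L) {I : Order.Ideal (Set ℕ)} [I.IsProper]
    (hI : IsAtomless I) (U : Ultrafilter ℕ) (hU : (U : Filter ℕ) ≤ idealFilter I) :
    IsPower B (fun _ => true) (fun _ => true) (idealFrame hI U hU) (RedPower I B)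
      (fun _ f => RepSeq.mk I B f) where
  surjective _ a := ⟨⟨RepSeq.rep a, continuous_of_discreteTopology⟩, RepSeq.mk_rep a⟩
  dist _ f g := RedPower.isEssSup_dist I B f g
  func f x _ hy := (RedPower.func_mk I B f fun i => x i).trans
    (congrArg (RepSeq.mk I B) (funext fun j => (hy j).symm))
  rel R x := RedPower.isEssSup_rel I B R fun i => x i

/-! ### Pairs as powers -/

section Pair

/-- The structure `(B, B, id)`. -/
def diagPair (B : MetricStructure.{u, v} L) : MetricStructure.{u, v} L.pair :=
  pairStructure B B (fun _ x => x) fun _ _ _ => le_rfl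

variable (B : MetricStructure.{u, v} L)

/-- Continuous functions on the Cantor space as representatives of the elements of
`(KB, B, π)`, where `π` is the evaluation at `p`. -/
def pairKRep (p : Cantor) : ∀ S, C(Cantor, (diagPair B).carrier S) →
    (pairStructure (KStr B) B (evalAt B p) (dist_evalAt_le B p)).carrier S
  | .inl _ => fun f => f
  | .inr _ => fun f => f p

/-- `Sum.isLeft` selects the filter for the first copy and the ultrafilter for the second. The
symbol for the projection is the identity in `(B, B, id)`, so on representatives it changes nothing:
it takes the class `f` to the class `f p`. -/
lemma isPower_pairKStr (p : Cantor) : IsPower (diagPair B) Sum.isLeft Sum.isLeft (cantorFrame p)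
    (pairStructure (KStr B) B (evalAt B p) (dist_evalAt_le B p)) (pairKRep B p) where
  surjective
    | .inl _ => fun f => ⟨f, rfl⟩
    | .inr S => fun b => ⟨(ContinuousMap.const Cantor b : C(Cantor, B.carrier S)), rfl⟩
  dist
    | .inl S => fun f g => KStr.isEssSup_dist B (S := S) f g
    | .inr S => fun (f g : C(Cantor, B.carrier S)) => isEssSup_pure p fun j => dist (f j) (g j)
  func
    | .inl (.inl _) => fun _ _ hy => ContinuousMap.ext fun j => (hy j).symm
    | .inl (.inr _) => fun _ _ hy => (hy p).symm
    | .inr _ => fun _ _ hy => (hy p).symm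
  rel
    | .inl R => fun x => KStr.isEssSup_rel B R x
    | .inr R => fun x => isEssSup_pure p fun j => B.rel R fun i => x i j

/-- Sequences as representatives of the elements of the pair of a reduced power and an
ultrapower. -/
noncomputable def pairRedRep {I : Order.Ideal (Set ℕ)} [I.IsProper] {U : Ultrafilter ℕ} (hU : ∀ X ∈ U, X ∉ I) :
    ∀ S, C(ℕ, (diagPair B).carrier S) →
      (pairStructure (RedPower I B) (RedPower (dualIdeal U) B) (quotMap (le_dualIdeal hU) B)
        (dist_quotMap_le (le_dualIdeal hU) B)).carrier S
  | .inl _ => fun f => RepSeq.mk I B f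
  | .inr _ => fun f => RepSeq.mk (dualIdeal U) B f

/-- The quotient map keeps representatives, and the dual filter of `dualIdeal U` is `U` itself. -/
lemma isPower_pairRedPower {I : Order.Ideal (Set ℕ)} [I.IsProper] (hI : IsAtomless I)
    {U : Ultrafilter ℕ} (hU : ∀ X ∈ U, X ∉ I) (hUI : (U : Filter ℕ) ≤ idealFilter I) :
    IsPower (diagPair B) Sum.isLeft Sum.isLeft (idealFrame hI U hUI)
      (pairStructure (RedPower I B) (RedPower (dualIdeal U) B) (quotMap (le_dualIdeal hU) B)
        (dist_quotMap_le (le_dualIdeal hU) B)) (pairRedRep B hU) where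
  surjective
    | .inl S => (isPower_RedPower B hI U hUI).surjective S
    | .inr S => fun a => ⟨(⟨RepSeq.rep (S := S) a, continuous_of_discreteTopology⟩ :
        C(ℕ, B.carrier S)), RepSeq.mk_rep a⟩
  dist
    | .inl S => (isPower_RedPower B hI U hUI).dist S
    | .inr S => fun f g => by
      have h := RedPower.isEssSup_dist (dualIdeal U) B (S := S) f g
      rw [idealFilter_dualIdeal] at h
      exact h
  func
    | .inl (.inl f) => (isPower_RedPower B hI U hUI).func f
    | .inl (.inr f) => fun x y hy => (RedPower.func_mk (dualIdeal U) B f fun i => x i).trans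
        (congrArg (RepSeq.mk (dualIdeal U) B) (funext fun j => (hy j).symm))
    | .inr S => fun x y hy => congrArg (RepSeq.mk (dualIdeal U) B (S := S))
        (funext fun j => (hy j).symm)
  rel
    | .inl R => (isPower_RedPower B hI U hUI).rel R
    | .inr R => fun x => by
      have h := RedPower.isEssSup_rel (dualIdeal U) B R fun i => x i
      rw [idealFilter_dualIdeal] at h
      exact h

end Pair

/-! ### Dyadic trees -/

/-- Dyadic trees of positive sets exist, and a given branch can be put into a given ultrafilter. -/
lemma exists_dyadicTree {I : Order.Ideal (Set ℕ)} [I.IsProper] (hI : IsAtomless I)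
    (U : Ultrafilter ℕ) (p : Cantor) : ∃ T : DyadicTree I, ∀ n, T.X (initSeg p n) ∈ U := by
  have hsplit : ∀ (X : {X : Set ℕ // X ∉ I}) (b : Bool), ∃ Y : Bool → {X : Set ℕ // X ∉ I},
      (Y false).1 ∪ (Y true).1 = X.1 ∧ Disjoint (Y false).1 (Y true).1 ∧
        (X.1 ∈ U → (Y b).1 ∈ U) := by
    rintro ⟨X, hX⟩ b
    obtain ⟨Y, hYX, hY, hXY⟩ := hI.exists_split hX
    have key : ∀ Z W : {X : Set ℕ // X ∉ I}, Z.1 ∪ W.1 = X → Disjoint Z.1 W.1 →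
        (X ∈ U → Z.1 ∈ U) → ∃ Y : Bool → {X : Set ℕ // X ∉ I},
        (Y false).1 ∪ (Y true).1 = X ∧ Disjoint (Y false).1 (Y true).1 ∧
          (X ∈ U → (Y b).1 ∈ U) := by
      intro Z W hZW hd h
      cases b with
      | true => exact ⟨fun c => cond c Z W, (Set.union_comm _ _).trans hZW, hd.symm, h⟩
      | false => exact ⟨fun c => cond c W Z, hZW, hd, h⟩
    by_cases hYU : Y ∈ U
    · exact key ⟨Y, hY⟩ ⟨X \ Y, hXY⟩ (Set.union_sdiff_cancel hYX) Set.disjoint_sdiff_right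
        fun _ => hYU
    · exact key ⟨X \ Y, hXY⟩ ⟨Y, hY⟩ (Set.sdiff_union_of_subset hYX) Set.disjoint_sdiff_left
        fun hXU => inter_mem hXU (Ultrafilter.compl_mem_iff_notMem.2 hYU)
  choose Y hY1 hY2 hY3 using hsplit
  -- Recursion on lists works at the head while the tree grows at the end, so `Z` reads sequences
  -- reversed. The split at level `n` sends membership in `U` towards the bit `p n`.
  let Z : List Bool → {X : Set ℕ // X ∉ I} := fun s =>
    List.rec ⟨Set.univ, univ_notMem I⟩ (fun c s X => Y X (p s.length) c) s
  have hZ : ∀ s c, Z (s ++ [c]).reverse = Y (Z s.reverse) (p s.length) c := by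
    intro s c
    rw [List.reverse_append, List.reverse_singleton, List.singleton_append]
    change Y (Z s.reverse) (p s.reverse.length) c = _
    rw [List.length_reverse]
  refine ⟨⟨fun s => (Z s.reverse).1, rfl, fun s => ?_, fun s => ?_, fun s => (Z s.reverse).2⟩,
    fun n => ?_⟩
  · rw [hZ, hZ, hY1]
  · rw [hZ, hZ]
    exact hY2 _ _
  · induction n with
    | zero => exact univ_mem
    | succ n ih =>
      dsimp only at ih ⊢
      rw [initSeg_succ, hZ]
      have : (initSeg p n).length = n := List.length_ofFn
      rw [this]
      exact hY3 _ _ ih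

/-! ### The branch map of a dyadic tree and the embedding it induces -/

namespace DyadicTree

variable {I : Order.Ideal (Set ℕ)} (T : DyadicTree I)

lemma subset_of_append (s : List Bool) (b : Bool) : T.X (s ++ [b]) ⊆ T.X s := by
  rw [← T.union s]
  cases b
  · exact Set.subset_union_left
  · exact Set.subset_union_right

lemma exists_branch (j : ℕ) : ∃ x : Cantor, ∀ n, j ∈ T.X (initSeg x n) := by
  have hstep : ∀ s : {s // j ∈ T.X s}, ∃ b, j ∈ T.X (s.1 ++ [b]) := by
    rintro ⟨s, hs⟩
    rw [← T.union s] at hs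
    exact hs.elim (fun h => ⟨false, h⟩) fun h => ⟨true, h⟩
  choose b hb using hstep
  let σ : ℕ → {s // j ∈ T.X s} := fun n => Nat.rec ⟨[], T.root ▸ Set.mem_univ j⟩
    (fun _ s => ⟨s.1 ++ [b s], hb s⟩) n
  have hσ : ∀ n, initSeg (fun n => b (σ n)) n = (σ n).1 := by
    intro n
    induction n with
    | zero => rfl
    | succ n ih => rw [initSeg_succ, ih]
  exact ⟨fun n => b (σ n), fun n => hσ n ▸ (σ n).2⟩

/-- The branch of the tree that consists of the sets containing `j`. -/
noncomputable def branch (j : ℕ) : Cantor := (T.exists_branch j).choose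

lemma mem_branch (j n : ℕ) : j ∈ T.X (initSeg (T.branch j) n) := (T.exists_branch j).choose_spec n

/-- Siblings are disjoint, so at each level only one set of the tree contains `j`. -/
lemma initSeg_branch {j n : ℕ} {x : Cantor} (h : j ∈ T.X (initSeg x n)) :
    initSeg (T.branch j) n = initSeg x n := by
  induction n with
  | zero => rfl
  | succ n ih =>
    rw [initSeg_succ] at h
    have e := ih (T.subset_of_append _ _ h)
    have h' := T.mem_branch j (n + 1)
    rw [initSeg_succ, e] at h'
    rw [initSeg_succ, initSeg_succ, e]
    have hd : j ∈ T.X (initSeg x n ++ [false]) → j ∉ T.X (initSeg x n ++ [true]) := fun h₀ =>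
      Set.disjoint_left.1 (T.disjoint _) h₀
    congr 2
    cases hx : x n <;> cases hb : T.branch j n <;> rw [hx] at h <;> rw [hb] at h'
    · exact absurd h' (hd h)
    · exact absurd h (hd h')

/-- The branch map, as a continuous map on the discrete space `ℕ`. -/
noncomputable def branchMap : C(ℕ, Cantor) := ⟨T.branch, continuous_of_discreteTopology⟩

/-- The preimage of a cylinder contains a set of the tree, which is positive. -/
lemma mapClusterPt_branch (x : Cantor) : MapClusterPt x (idealFilter I) T.branch := by
  rw [mapClusterPt_iff_frequently]
  intro V hV
  obtain ⟨n, hn⟩ := exists_initSeg_subset hV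
  rw [frequently_idealFilter]
  exact fun h => T.pos (initSeg x n) (I.lower (fun _ hj => hn _ (T.initSeg_branch hj)) h)

lemma tendsto_branch {U : Ultrafilter ℕ} {p : Cantor} (h : ∀ n, T.X (initSeg p n) ∈ U) :
    Tendsto T.branch U (𝓝 p) := by
  intro V hV
  obtain ⟨n, hn⟩ := exists_initSeg_subset hV
  exact mem_map.2 (mem_of_superset (h n) fun j hj => hn _ (T.initSeg_branch hj))

/-- Each value of `r` is approximated positively often because each point of `K` is a cluster point
of the branch map. Conversely, each value of the pullback is a value of `r`. The common limit is `r
p`. -/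
lemma close_branch (hI : IsAtomless I) {U : Ultrafilter ℕ} (hU : (U : Filter ℕ) ≤ idealFilter I)
    {p : Cantor} (hp : Tendsto T.branch U (𝓝 p)) {X : Type} [PseudoMetricSpace X]
    (r : Cantor → X) (hr : Continuous r) {δ : ℝ} (hδ : 0 < δ) :
    Close (cantorFrame p) (idealFrame hI U hU) r (fun j => r (T.branchMap j)) δ := by
  refine ⟨Eventually.of_forall fun x => ?_, Eventually.of_forall fun j => ?_, r p, ?_, ?_⟩
  · refine mapClusterPt_iff_frequently.1 (T.mapClusterPt_branch x) {y | dist (r x) (r y) < δ} ?_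
    exact (isOpen_lt (continuous_const.dist hr) continuous_const).mem_nhds (by simpa using hδ)
  · exact frequently_top.2 ⟨T.branch j, by simpa [branchMap] using hδ⟩
  · exact eventually_pure.2 (by simpa using hδ)
  · exact hp.eventually ((isOpen_lt (hr.dist continuous_const) continuous_const).mem_nhds
      (by simpa using hδ))

section Embedding

variable [I.IsProper] (B : MetricStructure.{u, v} L)

/-- Composition with the branch map, as a map from `KB` to the reduced power. -/
noncomputable def embedding : SortedMap (KStr B) (RedPower I B) :=
  fun S f => RepSeq.mk I B fun j => (show C(Cantor, B.carrier S) from f) (T.branch j)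

lemma induces_embedding : T.Induces B (T.embedding B) := by
  refine ⟨fun S => ?_, fun S n f _ a ha => ?_⟩
  · refine (LipschitzWith.of_dist_le_mul (K := 1) fun f g => ?_).continuous
    rw [NNReal.coe_one, one_mul]
    exact RepSeq.dist_le I.bot_mem fun j _ => ContinuousMap.dist_apply_le_dist
      (f := (show C(Cantor, B.carrier S) from f)) (g := (show C(Cantor, B.carrier S) from g)) _
  · exact congrArg (RepSeq.mk I B) (funext fun j => (ha _ j (T.mem_branch j n)).symm)

/-- Two continuous maps that agree on the dense set of functions of finitely many coordinates are
equal. -/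
lemma eq_embedding {Ψ : SortedMap (KStr B) (RedPower I B)} (h : T.Induces B Ψ) :
    Ψ = T.embedding B := by
  funext S
  refine Continuous.ext_on (dense_finite_dependence (B.carrier S)) (h.1 S)
    ((T.induces_embedding B).1 S) ?_
  rintro f ⟨n, hf⟩
  exact h.2 S n f hf _ fun x j hj => hf _ _ (T.initSeg_branch hj)

lemma isElementaryEmbedding_embedding (hI : IsAtomless I) :
    IsElementaryEmbedding (T.embedding B) := by
  -- No ultrafilter is given here, but a frame needs one. Any cluster point of the branch map
  -- provides it.
  obtain ⟨U, hU, hp⟩ := mapClusterPt_iff_ultrafilter.1 (T.mapClusterPt_branch fun _ => false)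
  exact isElementaryEmbedding_of_comp (isPower_KStr B _) (isPower_RedPower B hI U hU) T.branchMap
    (fun X _ r hr δ hδ => T.close_branch hI hU hp r hr hδ) _ fun S f => rfl

lemma isElementaryEmbedding_pairMap (hI : IsAtomless I) {U : Ultrafilter ℕ}
    (hU : ∀ X ∈ U, X ∉ I) {p : Cantor} (hp : Tendsto T.branch U (𝓝 p)) :
    IsElementaryEmbedding (pairMap (T.embedding B) (diag (dualIdeal U) B) :
      SortedMap (pairStructure (KStr B) B (evalAt B p) (dist_evalAt_le B p))
        (pairStructure (RedPower I B) (RedPower (dualIdeal U) B) (quotMap (le_dualIdeal hU) B)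
          (dist_quotMap_le (le_dualIdeal hU) B))) := by
  have hUI : (U : Filter ℕ) ≤ idealFilter I := fun X hX =>
    Ultrafilter.compl_notMem_iff.1 fun h => hU _ h hX
  refine isElementaryEmbedding_of_comp (isPower_pairKStr B p) (isPower_pairRedPower B hI hU hUI)
    T.branchMap (fun X _ r hr δ hδ => T.close_branch hI hUI hp r hr hδ) _ ?_
  rintro (S | S) f
  · rfl
  · change C(Cantor, B.carrier S) at f
    -- In the second copy, `f ∘ β` and the constant `f p` represent the same element of the
    -- ultrapower, because `β` tends to `p` along `U`.
    refine SeparationQuotient.mk_eq_mk.2 (Metric.inseparable_iff.2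
      (le_antisymm (le_of_forall_pos_le_add fun ε hε => ?_) dist_nonneg))
    rw [zero_add]
    have h : ∀ᶠ j in idealFilter (dualIdeal U), dist (f p) (f (T.branch j)) < ε := by
      rw [idealFilter_dualIdeal]
      exact hp.eventually ((isOpen_lt (continuous_const.dist f.continuous)
        continuous_const).mem_nhds (by simpa using hε))
    exact RepSeq.dist_le (eventually_idealFilter.1 h) fun j hj => (not_not.1 hj).le

end Embedding

end DyadicTree

end ContLogic

theorem propositionP {L : ContLogic.MetricLanguage.{u}} (B : ContLogic.MetricStructure.{u, v} L)
    (I : Order.Ideal (Set ℕ)) [I.IsProper] (hI : ContLogic.IsAtomless I) :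
    (Nonempty (ContLogic.DyadicTree I) ∧
      ∀ T : ContLogic.DyadicTree I,
        (∃! Ψ : ContLogic.SortedMap (ContLogic.KStr B) (ContLogic.RedPower I B), T.Induces B Ψ) ∧
        ∀ Ψ : ContLogic.SortedMap (ContLogic.KStr B) (ContLogic.RedPower I B), T.Induces B Ψ →
          ContLogic.IsElementaryEmbedding Ψ ∧
          ∀ S (b : B.carrier S), Ψ S (ContLogic.diagK B S b) = ContLogic.diag I B S b) ∧
    ∀ (U : Ultrafilter ℕ) (hU : ∀ X ∈ U, X ∉ I) (p : ContLogic.Cantor),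
      ∃ (T : ContLogic.DyadicTree I)
        (Ψ : ContLogic.SortedMap (ContLogic.KStr B) (ContLogic.RedPower I B)),
        T.Induces B Ψ ∧
        ContLogic.IsElementaryEmbedding
          (ContLogic.pairMap Ψ (ContLogic.diag (ContLogic.dualIdeal U) B) :
            ContLogic.SortedMap
              (ContLogic.pairStructure (ContLogic.KStr B) B
                (ContLogic.evalAt B p) (ContLogic.dist_evalAt_le B p))
              (ContLogic.pairStructure (ContLogic.RedPower I B)
                (ContLogic.RedPower (ContLogic.dualIdeal U) B)
                (ContLogic.quotMap (ContLogic.le_dualIdeal hU) B)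
                (ContLogic.dist_quotMap_le (ContLogic.le_dualIdeal hU) B))) := by
  have hpart : ∀ T : ContLogic.DyadicTree I,
      (∃! Ψ : ContLogic.SortedMap (ContLogic.KStr B) (ContLogic.RedPower I B), T.Induces B Ψ) ∧
      ∀ Ψ : ContLogic.SortedMap (ContLogic.KStr B) (ContLogic.RedPower I B), T.Induces B Ψ →
        ContLogic.IsElementaryEmbedding Ψ ∧
        ∀ S (b : B.carrier S), Ψ S (ContLogic.diagK B S b) = ContLogic.diag I B S b := by
    refine fun T => ⟨⟨_, T.induces_embedding B, fun Ψ h => T.eq_embedding B h⟩, fun Ψ h => ?_⟩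
    rw [T.eq_embedding B h]
    exact ⟨T.isElementaryEmbedding_embedding B hI, fun S b => rfl⟩
  refine ⟨⟨?_, hpart⟩, fun U hU p => ?_⟩
  · obtain ⟨T, -⟩ := ContLogic.exists_dyadicTree hI (Filter.hyperfilter ℕ) fun _ => false
    exact ⟨T⟩
  · obtain ⟨T, hT⟩ := ContLogic.exists_dyadicTree hI U p
    exact ⟨T, _, T.induces_embedding B,
      T.isElementaryEmbedding_pairMap B hI hU (T.tendsto_branch hT)⟩
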